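/- Let $K$ be a field, let $n\ge m\ge 1$ be integers, let $S=K[x_1,\ldots,x_{n+m}]$, and let $$I=(x_1,\ldots,x_n)\cap(x_{n+1},\ldots,x_{n+m})\subset S.$$ A Stanley decomposition of $I$ is a finite decomposition $\mathcal D:\ I=\bigoplus_{i=1}^r m_iK[Z_i]$ as a $\mathbb Z^{n+m}$-graded $K$-vector space, where each $m_i\in I$ is homogeneous with respect to the $\mathbb Z^{n+m}$-grading, $Z_i\subset\{x_1,\ldots,x_{n+m}\}$, and $m_iK[Z_i]$ is a free $K[Z_i]$-module with basis $m_i$. Put $\operatorname{sdepth}(\mathcal D)=\min_i|Z_i|$, and let the Stanley depth $\operatorname{sdepth}(I)$ be the maximum of $\operatorname{sdepth}(\mathcal D)$ over all Stanley decompositions $\mathcal D$ of $I$. Let the Hilbert depth $\operatorname{hdepth}(I)$ be the maximal depth of a finitely generated ($\mathbb Z$-)graded $S$-module $N$ with the same Hilbert series as $I$ (each $x_i$ has degree $1$; the depth of $N$ is the maximal length of an $N$-regular sequence in $(x_1,\ldots,x_{n+m})$). Then: 1. If $n$ and $m$ are not both even, then $$\operatorname{sdepth}(I)=\operatorname{hdepth}(I)=\left\lceil\frac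 n2\right\rceil+\left\lceil\frac m2\right\rceil.$$ 2. If $n=2t$ and $m=2s$, then $$t+s\le\operatorname{sdepth}(I)\le\operatorname{hdepth}(I)=t+s+1.$$ In both cases, $\operatorname{hdepth}(I)=\left\lfloor\frac{n+m+2}{2}\right\rfloor$. -/

import Mathlib

open MvPolynomial

universe u v

namespace StanleyHilbert

section Modules

variable {K : Type u} [Field K]

/-- The `K`-subspace `m K[Z] = {u m : u ∈ K[Z]}` of a module `M` over `K[x_s : s ∈ σ]`, where
`K[Z]` is the subalgebra generated by the variables `x_s` with `s ∈ Z`. -/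
noncomputable def stanleySpace {σ : Type*} {M : Type v} [AddCommGroup M] [Module K M]
    [Module (MvPolynomial σ K) M] [IsScalarTower K (MvPolynomial σ K) M]
    (m : M) (Z : Finset σ) : Submodule K M :=
  (Subalgebra.toSubmodule (MvPolynomial.supported K (Z : Set σ))).map
    ((LinearMap.toSpanSingleton (MvPolynomial σ K) M m).restrictScalars K)

/-- A Stanley decomposition of a module `M` with multigrading `ℳ` (indexed by `ℤ^σ`):
finitely many homogeneous elements `m i` and sets of variables `Z i` such that
each `m i K[Z i]` is a free `K[Z i]`-module on `m i` and `M = ⨁ i, m i K[Z i]`.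
Since the `m i` are homogeneous, this is a decomposition into multigraded subspaces. -/
structure StanleyDecomposition {σ : Type*} {M : Type v} [AddCommGroup M] [Module K M]
    [Module (MvPolynomial σ K) M] [IsScalarTower K (MvPolynomial σ K) M]
    (ℳ : (σ → ℤ) → Submodule K M) where
  r : ℕ
  m : Fin r → M
  Z : Fin r → Finset σ
  homogeneous : ∀ i, ∃ a : σ → ℤ, m i ∈ ℳ a
  free : ∀ i, ∀ p ∈ MvPolynomial.supported K (Z i : Set σ), p • m i = 0 → p = 0
  isInternal : DirectSum.IsInternal fun i => stanleySpace (K := K) (m i) (Z i)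

/-- `sdepth 𝒟 = min_i |Z i|` for a Stanley decomposition `𝒟`. -/
noncomputable def StanleyDecomposition.sdepth {σ : Type*} {M : Type v} [AddCommGroup M]
    [Module K M] [Module (MvPolynomial σ K) M] [IsScalarTower K (MvPolynomial σ K) M]
    {ℳ : (σ → ℤ) → Submodule K M} (𝒟 : StanleyDecomposition ℳ) : ℕ∞ :=
  ⨅ i, ((𝒟.Z i).card : ℕ∞)

/-- The Stanley depth of a multigraded module: the maximal `sdepth 𝒟` over all its Stanley
decompositions `𝒟`. -/
noncomputable def stanleyDepth {σ : Type*} {M : Type v} [AddCommGroup M] [Module K M]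
    [Module (MvPolynomial σ K) M] [IsScalarTower K (MvPolynomial σ K) M]
    (ℳ : (σ → ℤ) → Submodule K M) : ℕ∞ :=
  ⨆ 𝒟 : StanleyDecomposition ℳ, 𝒟.sdepth

/-- `𝒩` makes `N` a `ℤ`-graded module over `K[x_s : s ∈ σ]`, every variable having degree `1`. -/
structure IsGradedModule {σ : Type*} {N : Type v} [AddCommGroup N] [Module K N]
    [Module (MvPolynomial σ K) N] (𝒩 : ℤ → Submodule K N) : Prop where
  isInternal : DirectSum.IsInternal 𝒩
  smul_mem : ∀ (i : ℕ) (j : ℤ) (p : MvPolynomial σ K) (x : N),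
    p.IsHomogeneous i → x ∈ 𝒩 j → p • x ∈ 𝒩 (i + j)

/-- The Hilbert series of a graded module, given by its coefficients `j ↦ dim_K N_j`. -/
noncomputable def hilbertSeries {N : Type v} [AddCommGroup N] [Module K N]
    (𝒩 : ℤ → Submodule K N) : ℤ → ℕ :=
  fun j => Module.finrank K (𝒩 j)

variable (K) in
/-- The depth of a (nonzero finitely generated graded) module `N` over `K[x_s : s ∈ σ]`: the
maximal length of an `N`-regular sequence in the ideal generated by the variables. -/
noncomputable def depth (σ : Type*) (N : Type v) [AddCommGroup N] [Module (MvPolynomial σ K) N] :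
    ℕ∞ :=
  ⨆ rs ∈ {rs : List (MvPolynomial σ K) |
      (∀ f ∈ rs, f ∈ Ideal.span (Set.range (X : σ → MvPolynomial σ K))) ∧
        RingTheory.Sequence.IsRegular N rs},
    (rs.length : ℕ∞)

/-- The Hilbert depth of a graded module `M` over `K[x_1, …, x_k]`: the maximal depth of a finitely
generated graded module `N` with the same Hilbert series as `M`. Every finitely generated module
is isomorphic to one in the universe of `K`. -/
noncomputable def hilbertDepth (k : ℕ) {M : Type v} [AddCommGroup M] [Module K M]
    (ℳ : ℤ → Submodule K M) : ℕ∞ :=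
  sSup {d : ℕ∞ | ∃ (N : Type u) (_ : AddCommGroup N) (_ : Module K N)
    (_ : Module (MvPolynomial (Fin k) K) N) (_ : IsScalarTower K (MvPolynomial (Fin k) K) N)
    (𝒩 : ℤ → Submodule K N),
      Module.Finite (MvPolynomial (Fin k) K) N ∧
      IsGradedModule (σ := Fin k) 𝒩 ∧
      hilbertSeries 𝒩 = hilbertSeries ℳ ∧
      d = depth K (Fin k) N}

end Modules

section Ideals

variable {K : Type u} [Field K]

/-- The part of multidegree `a` of an ideal: the multiples of the monomial `x^a` lying in `I`. -/
noncomputable def multidegreePart {σ : Type*} (I : Ideal (MvPolynomial σ K)) (a : σ → ℤ) :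
    Submodule K I :=
  (MvPolynomial.restrictSupport K {e : σ →₀ ℕ | ∀ s, (e s : ℤ) = a s}).comap
    (I.subtype.restrictScalars K)

/-- The part of degree `j` of an ideal: the homogeneous polynomials of degree `j` lying in `I`. -/
noncomputable def degreePart {σ : Type*} (I : Ideal (MvPolynomial σ K)) (j : ℤ) :
    Submodule K I :=
  (MvPolynomial.restrictSupport K {e : σ →₀ ℕ | (e.degree : ℤ) = j}).comap
    (I.subtype.restrictScalars K)

/-- The Stanley depth of a monomial ideal. -/
noncomputable def sdepth {σ : Type*} (I : Ideal (MvPolynomial σ K)) : ℕ∞ :=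
  stanleyDepth (multidegreePart I)

/-- The Hilbert depth of a homogeneous ideal of `K[x_1, …, x_k]`. -/
noncomputable def hdepth {k : ℕ} (I : Ideal (MvPolynomial (Fin k) K)) : ℕ∞ :=
  hilbertDepth k (degreePart I)

variable (K) in
/-- The ideal `(x_1, …, x_n) ∩ (x_{n+1}, …, x_{n+m})` of `K[x_1, …, x_{n+m}]`. -/
noncomputable def bipartiteIdeal (n m : ℕ) : Ideal (MvPolynomial (Fin (n + m)) K) :=
  Ideal.span (Set.range fun i : Fin n => X (Fin.castAdd m i)) ⊓
    Ideal.span (Set.range fun j : Fin m => X (Fin.natAdd n j))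

end Ideals

end StanleyHilbert

/-! Both upper bounds come from the two lowest Hilbert coefficients of `I`: `H(2) = nm` and `H(3) =
nm(n + m + 2)/2`. Suppose a graded module starts in degree 2 and has a regular sequence of length
`d` in the irrelevant ideal. After extending scalars to an infinite field, prime avoidance replaces
the sequence by linear forms `l_1, …, l_d`. Then `(a_i) ↦ ∑ l_i a_i` is injective from `d` copies of
the degree 2 part into the degree 3 part, so `d H(2) ≤ H(3)`, that is, `d ≤ ⌊(n + m + 2)/2⌋`. For a
Stanley decomposition the same inequality is a count: every monomial of degree 2 generates its own
summand, and multiplying it by `d` of its variables gives monomials of degree 3, all distinct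
because the sum is direct.

The bound is attained for Hilbert depth. With `h = 1/(1 - x)`, the Hilbert series of `I` is `(h^n -
1)(h^m - 1)`. It is enough to write it as a sum of terms `x^a h^d` with `⌊(n + m + 2)/2⌋ ≤ d ≤ n +
m`, since each term is the series of a shifted polynomial ring in `d` of the variables, and on the
direct sum of these rings the common initial variables form a regular sequence. A telescoping
identity reduces this to `h^c - 1` (`product_mem_hilbertCone`), which is treated using `u = x^2 h =
h - 2 + h⁻¹` (`exists_sum_of_powers`).

For the lower bound on Stanley depth, the nonempty subsets of an `n`-set are partitioned into
intervals `[A, B]` with `|B| ≥ ⌈n/2⌉` (`exists_interval_partition`). Products of such intervals for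
`n` and `m` partition the supports of the monomials of `I`, which gives a Stanley decomposition of
depth at least `⌈n/2⌉ + ⌈m/2⌉`. This number equals `⌊(n + m + 2)/2⌋` unless `n` and `m` are both
even, when it is one less. -/

namespace StanleyHilbert

/-! ### Interval partitions of the nonempty subsets of a finite set -/

section IntervalPartitions

/-- Reading `A` from left to right, starting in state `p` and switching the state after each
element of `A`, the number `x` is compatible with `A` if it has the parity of the state at `x`. -/
def ParityCompatible (p : ZMod 2) (A : Finset ℕ) (x : ℕ) : Prop :=
  (x : ZMod 2) = p + (A.filter (· < x)).card

lemma zmod_two_ne_iff {a b : ZMod 2} : a ≠ b ↔ a = b + 1 := by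
  revert a b; decide

/-- Induction on the largest possible element `n` of `C`. Compatibility at `n` says that the state
after reading the part of `A` below `n` is the parity of `n`, so that part and `p` are determined by
the induction hypothesis with final state `n`. The prescribed final state `e` then decides whether
`n` belongs to `A`. -/
lemma existsUnique_parityCompatible (n : ℕ) : ∀ (C : Finset ℕ), C ⊆ Finset.range n →
    ∀ e : ZMod 2, ∃! pA : ZMod 2 × Finset ℕ,
      pA.2 ⊆ C ∧ (∀ x ∈ C, ParityCompatible pA.1 pA.2 x) ∧ pA.1 + pA.2.card = e := by
  induction n with
  | zero =>
    intro C hC e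
    obtain rfl : C = ∅ := by simpa using hC
    refine ⟨(e, ∅), by simp, ?_⟩
    rintro ⟨p, A⟩ ⟨hA, -, h⟩
    obtain rfl : A = ∅ := by simpa using hA
    simpa using h
  | succ n ih =>
    intro C hC e
    by_cases hn : n ∈ C
    swap
    · refine ih C (fun x hx => ?_) e
      have := Finset.mem_range.1 (hC hx)
      have : x ≠ n := fun h => hn (h ▸ hx)
      exact Finset.mem_range.2 (by omega)
    have hC' : C.erase n ⊆ Finset.range n := by
      intro x hx
      have h1 := Finset.ne_of_mem_erase hx
      have := Finset.mem_range.1 (hC (Finset.mem_of_mem_erase hx))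
      exact Finset.mem_range.2 (by omega)
    obtain ⟨⟨p, A⟩, ⟨hA, hc, he⟩, huniq⟩ := ih (C.erase n) hC' n
    have hlt : ∀ x ∈ A, x < n := fun x hx => Finset.mem_range.1 (hC' (hA hx))
    have hnA : n ∉ A := fun h => lt_irrefl n (hlt n h)
    have hfilt : A.filter (· < n) = A := Finset.filter_true_of_mem hlt
    have key : ∀ (p' : ZMod 2) (A' : Finset ℕ), A' ⊆ C → (∀ x ∈ C, ParityCompatible p' A' x) →
        p' = p ∧ A'.erase n = A := by
      intro p' A' hA' hc'
      have hf : A'.filter (· < n) = A'.erase n := by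
        ext x
        simp only [Finset.mem_filter, Finset.mem_erase]
        constructor
        · rintro ⟨h1, h2⟩; exact ⟨h2.ne, h1⟩
        · rintro ⟨h1, h2⟩
          have := Finset.mem_range.1 (hC (hA' h2))
          exact ⟨h2, by omega⟩
      have h := huniq (p', A'.erase n) ⟨Finset.erase_subset_erase n hA', ?_, ?_⟩
      · simpa using h
      · intro x hx
        have h1 := Finset.mem_range.1 (hC' hx)
        have h2 := hc' x (Finset.mem_of_mem_erase hx)
        have h3 : (A'.erase n).filter (· < x) = A'.filter (· < x) := by
          ext y
          simp only [Finset.mem_filter, Finset.mem_erase]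
          constructor
          · rintro ⟨⟨-, h⟩, h'⟩; exact ⟨h, h'⟩
          · rintro ⟨h, h'⟩; exact ⟨⟨by omega, h⟩, h'⟩
        simpa [ParityCompatible, h3] using h2
      · have h2 := hc' n hn
        rw [ParityCompatible, hf] at h2
        exact h2.symm
    by_cases hen : e = n
    · refine ⟨(p, A), ⟨hA.trans (Finset.erase_subset _ _), ?_, by rw [hen]; exact he⟩, ?_⟩
      · intro x hx
        by_cases hxn : x = n
        · subst hxn
          simp only [ParityCompatible, hfilt]
          exact he.symm
        · exact hc x (Finset.mem_erase.2 ⟨hxn, hx⟩)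
      · rintro ⟨p', A'⟩ ⟨h1, h2, h3⟩
        obtain ⟨rfl, h4⟩ := key p' A' h1 h2
        have : n ∉ A' := by
          intro hnA'
          have h5 : A'.card = A.card + 1 := by
            rw [← h4, Finset.card_erase_add_one hnA']
          simp only at h3 he
          rw [h5, hen, Nat.cast_add, ← add_assoc, he] at h3
          simp at h3
        rw [Finset.erase_eq_of_notMem this] at h4
        rw [h4]
    · have hen' := zmod_two_ne_iff.1 hen
      refine ⟨(p, insert n A), ⟨?_, ?_, ?_⟩, ?_⟩
      · exact Finset.insert_subset hn (hA.trans (Finset.erase_subset _ _))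
      · intro x hx
        have hxn : x < n + 1 := Finset.mem_range.1 (hC hx)
        have hf : (insert n A).filter (· < x) = A.filter (· < x) := by
          rw [Finset.filter_insert, if_neg (by omega)]
        simp only [ParityCompatible, hf]
        by_cases hxn : x = n
        · subst hxn
          rw [hfilt]
          exact he.symm
        · exact hc x (Finset.mem_erase.2 ⟨hxn, hx⟩)
      · simp only [Finset.card_insert_of_notMem hnA, Nat.cast_add, Nat.cast_one]
        rw [← add_assoc, he, hen']
      · rintro ⟨p', A'⟩ ⟨h1, h2, h3⟩
        obtain ⟨rfl, h4⟩ := key p' A' h1 h2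
        have : n ∈ A' := by
          by_contra hnA'
          rw [Finset.erase_eq_of_notMem hnA'] at h4
          subst h4
          exact hen (h3.symm.trans he)
        rw [← h4, Finset.insert_erase this]

/-- No element of `A` precedes `min C`, so compatibility there forces `p` to be the parity of `min
C`. Prescribing that `|A|` is odd therefore amounts to prescribing the final state `min C + 1`. -/
lemma existsUnique_odd_parityCompatible {n : ℕ} {C : Finset ℕ} (hC : C ⊆ Finset.range n)
    (hne : C.Nonempty) : ∃! pA : ZMod 2 × Finset ℕ,
      pA.2 ⊆ C ∧ (∀ x ∈ C, ParityCompatible pA.1 pA.2 x) ∧ (pA.2.card : ZMod 2) = 1 := by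
  have hmin : ∀ (p : ZMod 2) (A : Finset ℕ), A ⊆ C → (∀ x ∈ C, ParityCompatible p A x) →
      p = (C.min' hne : ℕ) := by
    intro p A hA hc
    have h := hc _ (C.min'_mem hne)
    have h0 : A.filter (· < C.min' hne) = ∅ := by
      refine Finset.filter_eq_empty_iff.2 fun x hx => not_lt.2 (C.min'_le x (hA hx))
    rw [ParityCompatible, h0, Finset.card_empty, Nat.cast_zero, add_zero] at h
    exact h.symm
  obtain ⟨⟨p, A⟩, ⟨h1, h2, h3⟩, huniq⟩ :=
    existsUnique_parityCompatible n C hC ((C.min' hne : ℕ) + 1)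
  refine ⟨(p, A), ⟨h1, h2, ?_⟩, ?_⟩
  · have := hmin p A h1 h2
    simp only at h3
    rw [← this] at h3
    exact add_left_cancel h3
  · rintro ⟨p', A'⟩ ⟨h1', h2', h3'⟩
    refine huniq (p', A') ⟨h1', h2', ?_⟩
    simp only at h3' ⊢
    rw [h3', hmin p' A' h1' h2']

/-- An incompatible `x` is not in `A`, so from `x` to `x + 1` the parity of the number changes and
the state does not. -/
lemma parityCompatible_succ_of_not {p : ZMod 2} {A : Finset ℕ}
    (hA : ∀ x ∈ A, ParityCompatible p A x) {x : ℕ} (hx : ¬ ParityCompatible p A x) :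
    ParityCompatible p A (x + 1) := by
  have hxA : x ∉ A := fun h => hx (hA x h)
  have hf : A.filter (· < x + 1) = A.filter (· < x) := by
    ext y
    simp only [Finset.mem_filter]
    refine and_congr_right fun hy => ?_
    have : y ≠ x := fun h => hxA (h ▸ hy)
    omega
  replace hx := zmod_two_ne_iff.1 hx
  rw [ParityCompatible, hf, Nat.cast_add, hx, Nat.cast_one, add_assoc]
  have : (1 + 1 : ZMod 2) = 0 := by decide
  rw [this, add_zero]

/-- The cyclic successor on `{0, …, n - 1}` sends incompatible numbers injectively to compatible
ones, so at least half of the numbers are compatible, and strictly more than half because `n` is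
odd. -/
lemma card_parityCompatible {n : ℕ} (hn : Odd n) {p : ZMod 2} {A : Finset ℕ}
    (hAn : A ⊆ Finset.range n) (hA : ∀ x ∈ A, ParityCompatible p A x)
    (hodd : (A.card : ZMod 2) = 1) [DecidablePred (ParityCompatible p A)] :
    n + 1 ≤ 2 * ((Finset.range n).filter (ParityCompatible p A)).card := by
  have hpos : 0 < n := hn.pos
  have hle : ((Finset.range n).filter (fun x => ¬ ParityCompatible p A x)).card ≤
      ((Finset.range n).filter (ParityCompatible p A)).card := by
    refine Finset.card_le_card_of_injOn (fun x => if x + 1 = n then 0 else x + 1) ?_ ?_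
    · intro x hx
      simp only [Finset.coe_filter, Finset.mem_range, Set.mem_ofPred_eq] at hx ⊢
      have h := parityCompatible_succ_of_not hA hx.2
      split_ifs with hxn
      -- Wrapping around: if `n - 1` is incompatible, then the final state `p + |A|` is the parity
      -- of `n`. Since `n` and `|A|` are both odd, `p = 0`, and `0` is compatible.
      · refine ⟨hpos, ?_⟩
        rw [hxn] at h
        have hf : A.filter (· < n) = A :=
          Finset.filter_true_of_mem fun y hy => Finset.mem_range.1 (hAn hy)
        have h1 : (n : ZMod 2) = 1 := ZMod.natCast_eq_one_iff_odd.2 hn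
        rw [ParityCompatible, hf, hodd, h1] at h
        have : p = 0 := by simpa using h
        simp [ParityCompatible, this]
      · exact ⟨by omega, h⟩
    · intro x hx y hy hxy
      simp only at hxy
      split_ifs at hxy <;> omega
  have hsum := Finset.card_filter_add_card_filter_not (s := Finset.range n) (ParityCompatible p A)
  rw [Finset.card_range] at hsum
  obtain ⟨k, rfl⟩ := hn
  omega

/-- The nonempty subsets of a set with an odd number `n` of elements can be partitioned into
intervals `[A, B]` with `A ≠ ∅` and `2 |B| > n`. -/
lemma exists_interval_partition_of_odd {n : ℕ} (hn : Odd n) :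
    ∃ P : Finset (Finset (Fin n) × Finset (Fin n)),
      (∀ I ∈ P, I.1.Nonempty ∧ I.1 ⊆ I.2 ∧ n + 1 ≤ 2 * I.2.card) ∧
      ∀ C : Finset (Fin n), C.Nonempty → ∃! I, I ∈ P ∧ I.1 ⊆ C ∧ C ⊆ I.2 := by
  classical
  let ι : Fin n ↪ ℕ := Fin.valEmbedding
  have hι : ∀ C : Finset (Fin n), C.map ι ⊆ Finset.range n := by
    intro C x hx
    obtain ⟨y, -, rfl⟩ := Finset.mem_map.1 hx
    exact Finset.mem_range.2 y.2
  let top : ZMod 2 × Finset (Fin n) → Finset (Fin n) := fun pA =>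
    Finset.univ.filter fun x => ParityCompatible pA.1 (pA.2.map ι) x
  have hsub : ∀ (C : Finset (Fin n)) pA, C ⊆ top pA ↔
      ∀ x ∈ C.map ι, ParityCompatible pA.1 (pA.2.map ι) x := by
    intro C pA
    simp [Finset.subset_iff, top, ι]
  -- The intervals are `[A, top (p, A)]` with `A` itself compatible and `|A|` odd; `C` lies in such
  -- an interval exactly when `A ⊆ C` and all of `C` is compatible with `(p, A)`.
  let Q : Finset (ZMod 2 × Finset (Fin n)) :=
    Finset.univ.filter fun pA => pA.2 ⊆ top pA ∧ (pA.2.card : ZMod 2) = 1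
  refine ⟨Q.image fun pA => (pA.2, top pA), ?_, ?_⟩
  · intro I hI
    obtain ⟨⟨p, A⟩, hpA, rfl⟩ := Finset.mem_image.1 hI
    obtain ⟨h1, h2⟩ := (Finset.mem_filter.1 hpA).2
    constructor
    · rw [Finset.nonempty_iff_ne_empty]
      rintro h
      simp only at h h2
      simp [h] at h2
    · have h3 := card_parityCompatible hn (hι A) ((hsub A (p, A)).1 h1) (by simpa using h2)
      have h4 : (Finset.range n).filter (ParityCompatible p (A.map ι)) = (top (p, A)).map ι := by
        ext x
        simp only [Finset.mem_filter, Finset.mem_range, Finset.mem_map, top, Finset.mem_univ,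
          true_and]
        constructor
        · rintro ⟨hx, h⟩; exact ⟨⟨x, hx⟩, h, rfl⟩
        · rintro ⟨y, h, rfl⟩; exact ⟨y.2, h⟩
      rw [h4, Finset.card_map] at h3
      exact ⟨h1, h3⟩
  · intro C hC
    obtain ⟨⟨p, A⟩, ⟨h1, h2, h3⟩, huniq⟩ :=
      existsUnique_odd_parityCompatible (hι C) (Finset.map_nonempty.2 hC)
    obtain ⟨A, hAC, rfl⟩ := Finset.subset_map_iff.1 h1
    refine ⟨(A, top (p, A)), ⟨?_, hAC, (hsub _ _).2 h2⟩, ?_⟩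
    · refine Finset.mem_image.2 ⟨(p, A), ?_, rfl⟩
      refine Finset.mem_filter.2 ⟨Finset.mem_univ _, hAC.trans ((hsub _ _).2 h2), by simpa using h3⟩
    · rintro I ⟨hI, hI1, hI2⟩
      obtain ⟨⟨p', A'⟩, hpA, rfl⟩ := Finset.mem_image.1 hI
      obtain ⟨h1', h2'⟩ := (Finset.mem_filter.1 hpA).2
      have h := huniq (p', A'.map ι)
        ⟨Finset.map_subset_map.2 hI1, (hsub _ _).1 hI2, by simpa using h2'⟩
      obtain ⟨rfl, h5⟩ := Prod.mk.inj h
      obtain rfl := Finset.map_injective ι h5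
      rfl

/-- The nonempty subsets of a set with `n ≥ 1` elements can be partitioned into
intervals `[A, B]` with `A ≠ ∅` and `2 |B| ≥ n`. -/
theorem exists_interval_partition {n : ℕ} (hn : 1 ≤ n) :
    ∃ P : Finset (Finset (Fin n) × Finset (Fin n)),
      (∀ I ∈ P, I.1.Nonempty ∧ I.1 ⊆ I.2 ∧ (n + 1) / 2 ≤ I.2.card) ∧
      ∀ C : Finset (Fin n), C.Nonempty → ∃! I, I ∈ P ∧ I.1 ⊆ C ∧ C ⊆ I.2 := by
  classical
  rcases Nat.even_or_odd n with he | ho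
  swap
  · obtain ⟨P, h1, h2⟩ := exists_interval_partition_of_odd ho
    exact ⟨P, fun I hI => ⟨(h1 I hI).1, (h1 I hI).2.1, by have := (h1 I hI).2.2; omega⟩, h2⟩
  obtain ⟨k, rfl⟩ : ∃ k, n = k + 1 := ⟨n - 1, by omega⟩
  have hk : Odd k := by
    rcases Nat.even_or_odd k with h | h
    · exact absurd he (by simpa [parity_simps] using h)
    · exact h
  obtain ⟨P, h1, h2⟩ := exists_interval_partition_of_odd hk
  let ι : Fin k ↪ Fin (k + 1) := Fin.castSuccEmb
  have hlast : ∀ A : Finset (Fin k), Fin.last k ∉ A.map ι := by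
    intro A h
    obtain ⟨y, -, hy⟩ := Finset.mem_map.1 h
    exact absurd hy (Fin.castSucc_lt_last y).ne
  have hpre : ∀ C : Finset (Fin (k + 1)), Fin.last k ∉ C → ∃ C' : Finset (Fin k), C'.map ι = C := by
    intro C hC
    have : C ⊆ Finset.univ.map ι := by
      intro x hx
      have hx' : x ≠ Fin.last k := fun h => hC (h ▸ hx)
      obtain ⟨y, rfl⟩ := Fin.exists_castSucc_eq.2 hx'
      exact Finset.mem_map.2 ⟨y, Finset.mem_univ _, rfl⟩
    obtain ⟨C', -, h⟩ := Finset.subset_map_iff.1 this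
    exact ⟨C', h.symm⟩
  -- For even `n = k + 1`, the sets containing the last element form the single interval `[{last},
  -- univ]`. The others are subsets of a set of odd size `k`, where `2 |B| ≥ k + 1 = n` already
  -- holds.
  refine ⟨insert ({Fin.last k}, Finset.univ) (P.image fun I => (I.1.map ι, I.2.map ι)), ?_, ?_⟩
  · intro I hI
    rcases Finset.mem_insert.1 hI with rfl | hI
    · simp only [Finset.singleton_nonempty, Finset.card_univ, Fintype.card_fin, true_and,
        Finset.subset_univ]
      omega
    · obtain ⟨J, hJ, rfl⟩ := Finset.mem_image.1 hI
      have := h1 J hJ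
      simp only [Finset.map_nonempty, Finset.card_map]
      exact ⟨this.1, Finset.map_subset_map.2 this.2.1, by omega⟩
  · intro C hC
    by_cases hCl : Fin.last k ∈ C
    · refine ⟨({Fin.last k}, Finset.univ), ⟨Finset.mem_insert_self _ _, by simpa using hCl,
        Finset.subset_univ _⟩, ?_⟩
      rintro I ⟨hI, -, hI2⟩
      rcases Finset.mem_insert.1 hI with rfl | hI
      · rfl
      · obtain ⟨J, hJ, rfl⟩ := Finset.mem_image.1 hI
        exact absurd (hI2 hCl) (hlast _)
    · obtain ⟨C, rfl⟩ := hpre C hCl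
      obtain ⟨J, ⟨hJ, hJ1, hJ2⟩, huniq⟩ := h2 C (Finset.map_nonempty.1 hC)
      refine ⟨(J.1.map ι, J.2.map ι), ⟨Finset.mem_insert_of_mem (Finset.mem_image_of_mem _ hJ),
        Finset.map_subset_map.2 hJ1, Finset.map_subset_map.2 hJ2⟩, ?_⟩
      rintro I ⟨hI, hI1, hI2⟩
      rcases Finset.mem_insert.1 hI with rfl | hI
      · exact absurd (hI1 (Finset.mem_singleton_self _)) hCl
      · obtain ⟨J', hJ', rfl⟩ := Finset.mem_image.1 hI
        rw [huniq J' ⟨hJ', Finset.map_subset_map.1 hI1, Finset.map_subset_map.1 hI2⟩]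

end IntervalPartitions

/-! ### Regular sequences and prime avoidance -/

section RegularSequences

open RingTheory.Sequence Pointwise TensorProduct

variable {A : Type*} [CommRing A]

/-- Reductions modulo two ring elements commute. -/
noncomputable def quotSMulTopComm (r s : A) (M : Type*) [AddCommGroup M] [Module A M] :
    QuotSMulTop r (QuotSMulTop s M) ≃ₗ[A] QuotSMulTop s (QuotSMulTop r M) :=
  QuotSMulTop.equivQuotTensor r _ ≪≫ₗ
    QuotSMulTop.tensorQuotSMulTopEquivQuotSMulTop s _ M ≪≫ₗ
    QuotSMulTop.congr s (QuotSMulTop.equivQuotTensor r M).symm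

/-- If `r x = s y`, regularity of `s` on `M/rM` gives `y = r z`, and cancelling `r` gives `x = s z`.
-/
lemma isSMulRegular_quotSMulTop_swap {M : Type*} [AddCommGroup M] [Module A M] {r s : A}
    (hr : IsSMulRegular M r) (hs : IsSMulRegular (QuotSMulTop r M) s) :
    IsSMulRegular (QuotSMulTop s M) r := by
  refine (isSMulRegular_quotient_iff_mem_of_smul_mem _ _).2 fun x hx => ?_
  obtain ⟨y, -, hy⟩ := (Submodule.mem_smul_pointwise_iff_exists _ _ _).1 hx
  have h1 : y ∈ r • (⊤ : Submodule A M) := by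
    refine mem_of_isSMulRegular_quotient_of_smul_mem hs ?_
    rw [hy]
    exact Submodule.smul_mem_pointwise_smul x r ⊤ trivial
  obtain ⟨z, -, rfl⟩ := (Submodule.mem_smul_pointwise_iff_exists _ _ _).1 h1
  have h2 : x = s • z := hr (by simp only [← hy]; rw [smul_comm])
  rw [h2]
  exact Submodule.smul_mem_pointwise_smul z s ⊤ trivial

/-- A regular sequence in `J` has no nontrivial linear relation with coefficients from a space `W`
embedding into `M/JM`. Modulo the first entry `l` the relation involves only the tail, and `W` still
embeds because `lM ⊆ JM`; so the tail coefficients vanish by induction, and then `l • φ (a 0) = 0`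
lets `l` be cancelled. -/
lemma eq_zero_of_sum_smul_eq_zero_of_isWeaklyRegular {W : Type*} [AddCommGroup W] (J : Ideal A)
    (ls : List A) (hJ : ∀ l ∈ ls, l ∈ J) :
    ∀ (M : Type v) [AddCommGroup M] [Module A M] (φ : W →+ M),
      (∀ w, φ w ∈ (J • ⊤ : Submodule A M) → w = 0) → IsWeaklyRegular M ls →
      ∀ a : Fin ls.length → W, ∑ i, ls.get i • φ (a i) = 0 → a = 0 := by
  induction ls with
  | nil => intro M _ _ φ _ _ a _; ext i; exact i.elim0
  | cons l ls ih =>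
    intro M _ _ φ hφ hreg a ha
    rw [isWeaklyRegular_cons_iff] at hreg
    let N : Submodule A M := l • (⊤ : Submodule A M)
    have hN : N ≤ J • ⊤ := by
      intro x hx
      obtain ⟨y, -, rfl⟩ := (Submodule.mem_smul_pointwise_iff_exists _ _ _).1 hx
      exact Submodule.smul_mem_smul (hJ l List.mem_cons_self) trivial
    have ha' : l • φ (a 0) + ∑ i : Fin ls.length, ls.get i • φ (a i.succ) = 0 :=
      (Fin.sum_univ_succ (n := ls.length)
        fun i : Fin (ls.length + 1) => (l :: ls).get i • φ (a i)).symm.trans ha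
    have htail : (fun i : Fin ls.length => a i.succ) = 0 := by
      refine ih (fun g hg => hJ g (List.mem_cons_of_mem _ hg)) (QuotSMulTop l M)
        (N.mkQ.toAddMonoidHom.comp φ) ?_ hreg.2 _ ?_
      · intro w hw
        refine hφ w ?_
        have h1 : (J • ⊤ : Submodule A (M ⧸ N)) = (J • ⊤ : Submodule A M).map N.mkQ := by
          rw [Submodule.map_smul'', Submodule.map_top, Submodule.range_mkQ]
        have h2 : N.mkQ (φ w) ∈ (J • ⊤ : Submodule A M).map N.mkQ := h1 ▸ hw
        obtain ⟨z, hz, hzw⟩ := h2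
        have h3 : φ w - z ∈ N := (Submodule.Quotient.eq N).1 hzw.symm
        have := (J • ⊤ : Submodule A M).add_mem (hN h3) hz
        simpa using this
      · have h1 := congrArg N.mkQ ha'
        rw [map_add, map_sum, map_zero] at h1
        have h2 : N.mkQ (l • φ (a 0)) = 0 := by
          rw [Submodule.mkQ_apply, Submodule.Quotient.mk_eq_zero]
          exact Submodule.smul_mem_pointwise_smul _ l ⊤ trivial
        rw [h2, zero_add] at h1
        rw [← h1]
        rfl
    have hsum : l • φ (a 0) = 0 := by
      have h1 : ∀ i : Fin ls.length, a i.succ = 0 := fun i => congrFun htail i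
      simpa [h1] using ha'
    have h0 : a 0 = 0 := by
      refine hφ _ ?_
      rw [hreg.1.right_eq_zero_of_smul hsum]
      exact Submodule.zero_mem _
    ext i
    refine Fin.cases h0 (fun j => congrFun htail j) i

variable [IsNoetherianRing A]

/-- The exchange step: the last entry `f` is traded for a generic `l` placed in front. The ideals to
avoid are the associated primes of `M` and of its successive quotients by the entries of `rs`. None
contains `J`, because the next entry of the sequence is an element of `J` outside all of them.
Regularity of `l` on each quotient allows it to be moved to the front by swapping. -/
lemma exists_finite_ideals_of_isWeaklyRegular_concat (J : Ideal A) (f : A) (hf : f ∈ J)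
    (rs : List A) (hrs : ∀ g ∈ rs, g ∈ J) :
    ∀ (M : Type v) [AddCommGroup M] [Module A M] [Module.Finite A M],
      IsWeaklyRegular M (rs ++ [f]) →
      ∃ T : Set (Ideal A), T.Finite ∧ (∀ p ∈ T, ¬ J ≤ p) ∧
        ∀ l, (∀ p ∈ T, l ∉ p) → IsSMulRegular M l ∧ IsWeaklyRegular (QuotSMulTop l M) rs := by
  have hass : ∀ (M : Type v) [AddCommGroup M] [Module A M], ∀ g ∈ J, IsSMulRegular M g →
      ∀ p ∈ associatedPrimes A M, ¬ J ≤ p := by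
    intro M _ _ g hg hreg p hp hJ
    have h : g ∈ ⋃ p ∈ associatedPrimes A M, (p : Set A) := Set.mem_biUnion hp (hJ hg)
    rw [biUnion_associatedPrimes_eq_compl_regular] at h
    exact h hreg
  have hreg : ∀ (M : Type v) [AddCommGroup M] [Module A M], ∀ l,
      (∀ p ∈ associatedPrimes A M, l ∉ p) → IsSMulRegular M l := by
    intro M _ _ l hl
    by_contra h
    have h' : l ∈ { r : A | IsSMulRegular M r }ᶜ := h
    rw [← biUnion_associatedPrimes_eq_compl_regular] at h'
    obtain ⟨p, hp, hlp⟩ := Set.mem_iUnion₂.1 h'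
    exact hl p hp hlp
  induction rs with
  | nil =>
    intro M _ _ _ h
    rw [List.nil_append, isWeaklyRegular_singleton_iff] at h
    exact ⟨associatedPrimes A M, associatedPrimes.finite A M, hass M f hf h,
      fun l hl => ⟨hreg M l hl, .nil A _⟩⟩
  | cons g rs ih =>
    intro M _ _ _ h
    rw [List.cons_append, isWeaklyRegular_cons_iff] at h
    obtain ⟨T, hT, hTJ, hTl⟩ := ih (fun g' hg' => hrs g' (List.mem_cons_of_mem _ hg'))
      (QuotSMulTop g M) h.2
    refine ⟨associatedPrimes A M ∪ T, (associatedPrimes.finite A M).union hT, ?_, ?_⟩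
    · rintro p (hp | hp)
      · exact hass M g (hrs g List.mem_cons_self) h.1 p hp
      · exact hTJ p hp
    · intro l hl
      obtain ⟨h1, h2⟩ := hTl l fun p hp => hl p (Or.inr hp)
      refine ⟨hreg M l fun p hp => hl p (Or.inl hp), ?_⟩
      rw [isWeaklyRegular_cons_iff]
      exact ⟨isSMulRegular_quotSMulTop_swap h.1 h1,
        ((quotSMulTopComm l g M).isWeaklyRegular_congr rs).1 h2⟩

/-- A weakly regular sequence in the ideal generated by a vector space `V` over an infinite field
can be replaced by one of the same length with elements in `V`. -/
theorem exists_isWeaklyRegular_mem_subspace {F : Type*} [Field F] [Infinite F] [Algebra F A]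
    (V : Submodule F A) (d : ℕ) :
    ∀ (M : Type v) [AddCommGroup M] [Module A M] [Module.Finite A M] (rs : List A),
      rs.length = d → (∀ f ∈ rs, f ∈ Ideal.span (V : Set A)) → IsWeaklyRegular M rs →
      ∃ ls : List A, ls.length = d ∧ (∀ l ∈ ls, l ∈ V) ∧ IsWeaklyRegular M ls := by
  classical
  induction d with
  | zero =>
    intro M _ _ _ rs _ _ _
    exact ⟨[], rfl, by simp, .nil A M⟩
  | succ d ih =>
    intro M _ _ _ rs hd hJ hrs
    obtain rfl | ⟨rs, f, rfl⟩ := rs.eq_nil_or_concat'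
    · simp at hd
    obtain ⟨T, hT, hTJ, hTl⟩ := exists_finite_ideals_of_isWeaklyRegular_concat
      (Ideal.span (V : Set A)) f (hJ f (by simp)) rs (fun g hg => hJ g (by simp [hg])) M hrs
    -- Each ideal to avoid cuts `V` in a proper subspace, and a vector space over an infinite field
    -- is not a finite union of proper subspaces.
    let s : Finset (Submodule F V) :=
      hT.toFinset.image fun p => (p.restrictScalars F).comap V.subtype
    have hs : ⊤ ∉ s := by
      intro h
      obtain ⟨p, hp, hpt⟩ := Finset.mem_image.1 h
      refine hTJ p (hT.mem_toFinset.1 hp) (Ideal.span_le.2 fun x hx => ?_)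
      have : (⟨x, hx⟩ : V) ∈ (p.restrictScalars F).comap V.subtype := hpt ▸ trivial
      exact this
    have hne := Subspace.biUnion_ne_univ_of_top_notMem hs
    obtain ⟨l, hl⟩ := (Set.ne_univ_iff_exists_notMem _).1 hne
    have hl' : ∀ p ∈ T, (l : A) ∉ p := by
      intro p hp hlp
      exact hl (Set.mem_biUnion (x := (p.restrictScalars F).comap V.subtype)
        (Finset.mem_coe.2 (Finset.mem_image_of_mem _ (hT.mem_toFinset.2 hp))) hlp)
    obtain ⟨h1, h2⟩ := hTl l hl'
    obtain ⟨ls, hlen, hlV, hls⟩ := ih (QuotSMulTop (l : A) M) rs (by simpa using hd)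
      (fun g hg => hJ g (by simp [hg])) h2
    refine ⟨l :: ls, by simp [hlen], ?_, (isWeaklyRegular_cons_iff _ _ _).2 ⟨h1, hls⟩⟩
    intro x hx
    rcases List.mem_cons.1 hx with rfl | hx
    · exact l.2
    · exact hlV x hx

end RegularSequences

/-! ### Graded modules and the bound from the two lowest degrees -/

section GradedModules

variable {K : Type u} [Field K] {σ : Type*} {N : Type v} [AddCommGroup N] [Module K N]
  {𝒩 : ℤ → Submodule K N}

/-- The projection of a graded vector space onto its component of degree `j`. -/
lemma exists_projection (h : DirectSum.IsInternal 𝒩) (j : ℤ) :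
    ∃ π : N →ₗ[K] 𝒩 j, (∀ x : 𝒩 j, π x = x) ∧ ∀ i, i ≠ j → ∀ x ∈ 𝒩 i, π x = 0 := by
  let _ := h.chooseDecomposition
  refine ⟨DirectSum.component K ℤ (fun i => 𝒩 i) j ∘ₗ
    (DirectSum.decomposeLinearEquiv 𝒩).toLinearMap, fun x => ?_, fun i hij x hx => ?_⟩
  · exact Subtype.ext (DirectSum.decompose_of_mem_same 𝒩 x.2)
  · exact Subtype.ext (DirectSum.decompose_of_mem_ne 𝒩 hx hij)

lemma induction_homogeneous (h : DirectSum.IsInternal 𝒩) {p : N → Prop}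
    (hmem : ∀ i, ∀ x ∈ 𝒩 i, p x) (h0 : p 0) (hadd : ∀ x y, p x → p y → p (x + y)) (x : N) :
    p x :=
  Submodule.iSup_induction 𝒩 (motive := p) (h.submodule_iSup_eq_top ▸ Submodule.mem_top : x ∈ ⨆ i, 𝒩 i)
    hmem h0 hadd

variable [Module (MvPolynomial σ K) N]

lemma IsGradedModule.X_smul_mem (h : IsGradedModule (σ := σ) 𝒩) (s : σ) {j : ℤ} {x : N}
    (hx : x ∈ 𝒩 j) : (X s : MvPolynomial σ K) • x ∈ 𝒩 (j + 1) := by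
  have := h.smul_mem 1 j (X s) x (isHomogeneous_X K s) hx
  rwa [Nat.cast_one, add_comm] at this

/-- A component of `X s • x` in the lowest degree `c` would have to come from degree `c - 1`, where
the module is zero. -/
lemma IsGradedModule.projection_X_smul (h : IsGradedModule (σ := σ) 𝒩) {c : ℤ}
    (hbot : ∀ j < c, 𝒩 j = ⊥) {π : N →ₗ[K] 𝒩 c} (hπ : ∀ i, i ≠ c → ∀ x ∈ 𝒩 i, π x = 0)
    (s : σ) (x : N) : π ((X s : MvPolynomial σ K) • x) = 0 := by
  refine induction_homogeneous h.isInternal (p := fun x => π ((X s : MvPolynomial σ K) • x) = 0)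
    (fun i x hx => ?_) (by simp) (fun x y hx hy => by rw [smul_add, map_add, hx, hy, add_zero]) x
  by_cases hi : i < c
  · rw [hbot i hi, Submodule.mem_bot] at hx
    simp [hx]
  · exact hπ (i + 1) (by omega) _ (h.X_smul_mem s hx)

variable [IsScalarTower K (MvPolynomial σ K) N]

/-- Only the constant term of `p` preserves the degree. -/
lemma IsGradedModule.projection_smul (h : IsGradedModule (σ := σ) 𝒩) {j : ℤ}
    {π : N →ₗ[K] 𝒩 j} (hπ1 : ∀ x : 𝒩 j, π x = x) (hπ : ∀ i, i ≠ j → ∀ x ∈ 𝒩 i, π x = 0)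
    (p : MvPolynomial σ K) (x : 𝒩 j) : π (p • (x : N)) = coeff 0 p • x := by
  induction p using MvPolynomial.induction_on' with
  | add p q hp hq => rw [add_smul, map_add, hp, hq, coeff_add, add_smul]
  | monomial e a =>
    classical
    rw [coeff_monomial]
    split_ifs with he
    · subst he
      rw [← C_apply, ← algebraMap_eq, algebraMap_smul, map_smul, hπ1]
    · rw [zero_smul]
      refine hπ (e.degree + j) ?_ _ (h.smul_mem e.degree j _ _ (isHomogeneous_monomial a rfl) x.2)
      have : e.degree ≠ 0 := fun h0 => he ((Finsupp.degree_eq_zero_iff e).1 h0)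
      omega

/-- The homogeneous components of a finitely generated graded module are finite-dimensional. -/
theorem IsGradedModule.finite_component [Finite σ] [Module.Finite (MvPolynomial σ K) N]
    (h : IsGradedModule (σ := σ) 𝒩) (j : ℤ) : Module.Finite K (𝒩 j) := by
  classical
  obtain ⟨π, hπ1, hπ⟩ := exists_projection h.isInternal j
  have hfg : (Submodule.span (MvPolynomial σ K) (𝒩 j : Set N)).FG := IsNoetherian.noetherian _
  -- Finitely many elements of `𝒩 j` generate the submodule spanned by `𝒩 j`; projecting to degree
  -- `j` replaces their polynomial coefficients by constant terms, so they span `𝒩 j` over `K`.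
  obtain ⟨s, hs, hspan⟩ := Submodule.fg_span_iff_fg_span_finset_subset _ |>.1 hfg
  refine Module.Finite.iff_fg.2 ⟨s, le_antisymm (Submodule.span_le.2 hs) fun x hx => ?_⟩
  have hx' : x ∈ Submodule.span (MvPolynomial σ K) (s : Set N) := hspan ▸ Submodule.subset_span hx
  obtain ⟨f, -, hf⟩ := Submodule.mem_span_finset.1 hx'
  have h1 : x = (π x : N) := by rw [hπ1 ⟨x, hx⟩]
  rw [h1, ← hf, map_sum, Submodule.coe_sum]
  refine Submodule.sum_mem _ fun y hy => ?_
  rw [h.projection_smul hπ1 hπ (f y) ⟨y, hs hy⟩]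
  exact Submodule.smul_mem _ _ (Submodule.subset_span hy)

section BaseChange

open TensorProduct RingTheory.Sequence

attribute [local instance] algebraMvPolynomial

/-- If a finitely generated graded module over a polynomial ring starts in degree `c` and has a
regular sequence of length `d` in the irrelevant ideal, then `d * dim N_c ≤ dim N_{c+1}`. -/
theorem IsGradedModule.length_mul_finrank_le [Finite σ] [Module.Finite (MvPolynomial σ K) N]
    (h : IsGradedModule (σ := σ) 𝒩) {c : ℤ} (hbot : ∀ j < c, 𝒩 j = ⊥)
    (rs : List (MvPolynomial σ K))
    (hrs : ∀ f ∈ rs, f ∈ Ideal.span (Set.range (X : σ → MvPolynomial σ K)))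
    (hreg : IsWeaklyRegular N rs) :
    rs.length * Module.finrank K (𝒩 c) ≤ Module.finrank K (𝒩 (c + 1)) := by
  -- Linear forms avoiding finitely many primes exist only over an infinite field, so scalars are
  -- extended to `F`. This preserves dimensions of components, and by flatness also weak regularity.
  let F := AlgebraicClosure K
  let S := MvPolynomial σ K
  let S' := MvPolynomial σ F
  let M := S' ⊗[S] N
  have : Infinite F := IsAlgClosed.instInfinite
  have := h.finite_component c
  have := h.finite_component (c + 1)
  let e : M ≃ₗ[F] F ⊗[K] N := Algebra.IsPushout.cancelBaseChange K F S S' N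
  have he : ∀ (a : F) (n : N), e.symm (a ⊗ₜ n) = algebraMap F S' a ⊗ₜ n := fun a n =>
    Algebra.IsPushout.cancelBaseChange_symm_tmul K F S S' N a n
  have hXX : ∀ s : σ, algebraMap S S' (X s) = X s := fun s => by
    change algebraMap (MvPolynomial σ K) (MvPolynomial σ F) (X s) = X s
    rw [MvPolynomial.algebraMap_def, map_X]
  have hX : ∀ (s : σ) (a : F) (n : N),
      (X s : S') • e.symm (a ⊗ₜ n) = e.symm (a ⊗ₜ ((X s : S) • n)) := by
    intro s a n
    rw [he, he, TensorProduct.tmul_smul, TensorProduct.smul_tmul', TensorProduct.smul_tmul']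
    congr 1
    exact (by rw [Algebra.smul_def, hXX]; rfl :
      (X s : S) • algebraMap F S' a = (X s : S') • algebraMap F S' a).symm
  have hflat : Module.Flat S S' :=
    Module.Flat.isBaseChange K S F S' (Algebra.IsPushout.out (R := K) (S := S) (R' := F) (S' := S'))
  obtain ⟨π, hπ1, hπ⟩ := exists_projection h.isInternal c
  obtain ⟨π', hπ1', hπ'⟩ := exists_projection h.isInternal (c + 1)
  let V : Submodule F S' := Submodule.span F (Set.range X)
  let J : Ideal S' := Ideal.span (V : Set S')
  have hJ : J = Ideal.span (Set.range (X : σ → S')) := by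
    refine le_antisymm (Ideal.span_le.2 fun x hx => ?_) (Ideal.span_mono Submodule.subset_span)
    refine Submodule.span_induction (p := fun x _ => x ∈ Ideal.span (Set.range (X : σ → S')))
      (fun x hx => Ideal.subset_span hx) (Ideal.zero_mem _) (fun _ _ _ _ => Ideal.add_mem _)
      (fun a x _ hx => ?_) hx
    rw [Algebra.smul_def]
    exact Ideal.mul_mem_left _ _ hx
  have hreg' : IsWeaklyRegular M (rs.map (algebraMap S S')) :=
    hreg.of_flat_of_isBaseChange (TensorProduct.isBaseChange S N S')
  obtain ⟨ls, hlen, hlV, hls⟩ := exists_isWeaklyRegular_mem_subspace V rs.length M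
    (rs.map (algebraMap S S')) (by simp) (by
      intro f hf
      obtain ⟨g, hg, rfl⟩ := List.mem_map.1 hf
      change algebraMap S S' g ∈ J
      have h1 := Ideal.mem_map_of_mem (algebraMap S S') (hrs g hg)
      rw [Ideal.map_span, ← Set.range_comp] at h1
      rw [hJ]
      convert h1 using 3
      ext s : 1
      exact (hXX s).symm) hreg'
  -- `Φ` and `Φ'` embed the components of degrees `c` and `c + 1`, with retractions `P` and `P'`.
  -- Since `c` is the lowest degree, `P` kills `J M`, so the degree `c` part embeds into `M/JM`.
  let Φ : F ⊗[K] 𝒩 c →ₗ[F] M := e.symm.toLinearMap ∘ₗ (𝒩 c).subtype.baseChange F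
  let P : M →ₗ[F] F ⊗[K] 𝒩 c := π.baseChange F ∘ₗ e.toLinearMap
  let Φ' : F ⊗[K] 𝒩 (c + 1) →ₗ[F] M := e.symm.toLinearMap ∘ₗ (𝒩 (c + 1)).subtype.baseChange F
  let P' : M →ₗ[F] F ⊗[K] 𝒩 (c + 1) := π'.baseChange F ∘ₗ e.toLinearMap
  have hPΦ : ∀ w, P (Φ w) = w := by
    intro w
    induction w with
    | zero => simp
    | add x y hx hy => rw [map_add, map_add, hx, hy]
    | tmul a x => simp [P, Φ, hπ1]
  have hPX : ∀ (s : σ) (y : M), P ((X s : S') • y) = 0 := by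
    intro s y
    obtain ⟨w, rfl⟩ := e.symm.surjective y
    induction w with
    | zero => simp
    | add x y hx hy => rw [map_add, smul_add, map_add, hx, hy, add_zero]
    | tmul a x =>
      rw [hX]
      simp [P, S, h.projection_X_smul hbot hπ]
  have hPJ : ∀ z ∈ (J • ⊤ : Submodule S' M), P z = 0 := by
    intro z hz
    refine Submodule.smul_induction_on hz (fun r hr y _ => ?_)
      (fun x y hx hy => by rw [map_add, hx, hy, add_zero])
    rw [hJ] at hr
    refine Submodule.span_induction (p := fun r _ => ∀ y : M, P (r • y) = 0) ?_ ?_ ?_ ?_ hr y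
    · rintro _ ⟨s, rfl⟩ y
      exact hPX s y
    · intro y
      rw [zero_smul, map_zero]
    · intro r r' _ _ hr hr' y
      rw [add_smul, map_add, hr, hr', add_zero]
    · intro a r _ hr y
      rw [smul_eq_mul, mul_comm, mul_smul]
      exact hr _
  have hΦP : ∀ l ∈ V, ∀ w, Φ' (P' (l • Φ w)) = l • Φ w := by
    intro l hl w
    refine Submodule.span_induction (p := fun l _ => Φ' (P' (l • Φ w)) = l • Φ w) ?_ ?_ ?_ ?_ hl
    · rintro _ ⟨s, rfl⟩
      induction w with
      | zero => simp
      | add x y hx hy => rw [map_add, smul_add, map_add, map_add, hx, hy]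
      | tmul a x =>
        have h1 : Φ (a ⊗ₜ x) = e.symm (a ⊗ₜ (x : N)) := rfl
        rw [h1, hX]
        have h2 := hπ1' ⟨_, h.X_smul_mem s x.2⟩
        simp only at h2
        simp [P', Φ', S, h2]
    · rw [zero_smul, map_zero, map_zero]
    · intro l l' _ _ hl hl'
      rw [add_smul, map_add, map_add, hl, hl']
    · intro a l _ hl
      rw [smul_assoc, map_smul, map_smul, hl]
  -- The map `(a_i) ↦ ∑ l_i a_i` from `d` copies of degree `c` to degree `c + 1`; its injectivity is
  -- the asserted inequality.
  let T : (Fin ls.length → F ⊗[K] 𝒩 c) →ₗ[F] F ⊗[K] 𝒩 (c + 1) :=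
    ∑ i, P' ∘ₗ Algebra.lsmul F F M (ls.get i) ∘ₗ Φ ∘ₗ LinearMap.proj i
  have hT : Function.Injective T := by
    rw [← LinearMap.ker_eq_bot, LinearMap.ker_eq_bot']
    intro a ha
    refine eq_zero_of_sum_smul_eq_zero_of_isWeaklyRegular J ls
      (fun l hl => Ideal.subset_span (hlV l hl)) M Φ.toAddMonoidHom
      (fun w hw => ?_) hls a ?_
    · rw [← hPΦ w]
      exact hPJ _ hw
    · have h1 : Φ' (T a) = ∑ i, ls.get i • Φ (a i) := by
        have h2 : T a = ∑ i, P' (ls.get i • Φ (a i)) := by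
          simp only [T, LinearMap.sum_apply]
          rfl
        rw [h2, map_sum]
        exact Finset.sum_congr rfl fun i _ =>
          hΦP (ls.get i) (hlV _ (List.get_mem ls i)) (a i)
      rw [ha, map_zero] at h1
      exact h1.symm
  have hfin := LinearMap.finrank_le_finrank_of_injective hT
  rw [Module.finrank_pi_fintype] at hfin
  simpa [Module.finrank_baseChange, hlen] using hfin

end BaseChange

end GradedModules

/-! ### Gradings given by a partition of a basis -/

section BasisGradings

variable {K : Type*} [Field K] {V : Type*} [AddCommGroup V] [Module K V] {ι κ : Type*}

/-- A map from the index set of a basis to `κ` decomposes the space into a direct sum over `κ`. -/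
lemma isInternal_of_basis [DecidableEq κ] (b : Module.Basis ι K V) (w : ι → κ)
    (W : κ → Submodule K V) (hW : ∀ k v, v ∈ W k ↔ ∀ i, w i ≠ k → b.repr v i = 0) :
    DirectSum.IsInternal W := by
  classical
  -- The `i`-th coordinate of a sum of elements of the `W k` sees only the summand with `k = w i`.
  have hcoord : ∀ i, b.coord i ∘ₗ DirectSum.coeLinearMap W =
      b.coord i ∘ₗ (W (w i)).subtype ∘ₗ DirectSum.component K κ (fun k => W k) (w i) := by
    intro i
    refine DirectSum.linearMap_ext _ fun k => LinearMap.ext fun v => ?_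
    by_cases hk : w i = k
    · subst hk
      simp [DirectSum.component.lof_self]
    · have h1 : DirectSum.component K κ (fun k => W k) (w i) (DirectSum.lof K κ _ k v) = 0 := by
        rw [DirectSum.component.of, dif_neg (Ne.symm hk)]
      simp only [LinearMap.comp_apply, h1, map_zero, DirectSum.coeLinearMap_lof]
      exact (hW k v).1 v.2 i hk
  constructor
  · change Function.Injective (DirectSum.coeLinearMap W)
    rw [← LinearMap.ker_eq_bot, LinearMap.ker_eq_bot']
    intro x hx
    refine DirectSum.ext_component K fun k => Subtype.ext (b.repr.injective (Finsupp.ext fun i => ?_))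
    by_cases hk : w i = k
    · subst hk
      have h1 := LinearMap.congr_fun (hcoord i) x
      simp only [LinearMap.comp_apply, hx, map_zero] at h1
      simpa using h1.symm
    · simpa using (hW k _).1 (DirectSum.component K κ (fun k => W k) k x).2 i hk
  · change Function.Surjective (DirectSum.coeLinearMap W)
    rw [← LinearMap.range_eq_top, eq_top_iff, ← b.span_eq, Submodule.span_le]
    rintro _ ⟨i, rfl⟩
    have hi : b i ∈ W (w i) := by
      rw [hW]
      intro j hj
      rw [b.repr_self, Finsupp.single_apply, if_neg]
      rintro rfl
      exact hj rfl
    exact ⟨DirectSum.lof K κ (fun k => W k) (w i) ⟨b i, hi⟩, DirectSum.coeLinearMap_lof _ _ _⟩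

lemma finrank_eq_card_of_basis (b : Module.Basis ι K V) (s : Set ι) [Finite s]
    (W : Submodule K V) (hW : ∀ v, v ∈ W ↔ ∀ i ∉ s, b.repr v i = 0) :
    Module.finrank K W = Nat.card s := by
  classical
  have := Fintype.ofFinite s
  have h1 : W = Submodule.span K (Set.range fun i : s => b i) := by
    refine le_antisymm (fun v hv => ?_) (Submodule.span_le.2 ?_)
    · rw [← b.linearCombination_repr v, Finsupp.linearCombination_apply]
      refine Submodule.sum_mem _ fun i hi => Submodule.smul_mem _ _ (Submodule.subset_span ?_)
      have : i ∈ s := by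
        by_contra h
        exact Finsupp.mem_support_iff.1 hi ((hW v).1 hv i h)
      exact ⟨⟨i, this⟩, rfl⟩
    · rintro _ ⟨i, rfl⟩
      refine (hW _).2 fun j hj => ?_
      rw [b.repr_self, Finsupp.single_apply, if_neg]
      intro h
      exact hj (h ▸ i.2)
  rw [h1, finrank_span_eq_card (b := fun i : s => b i)
    (b.linearIndependent.comp _ Subtype.val_injective),
    Nat.card_eq_fintype_card]

end BasisGradings

/-! ### The Hilbert function of the ideal -/

section HilbertFunction

/-- The exponents of the monomials in the ideal `(x_1, …, x_n) ∩ (x_{n+1}, …, x_{n+m})`. -/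
def bipartiteExponents (n m : ℕ) : Set (Fin (n + m) →₀ ℕ) :=
  {e | (∃ i : Fin n, e (Fin.castAdd m i) ≠ 0) ∧ ∃ j : Fin m, e (Fin.natAdd n j) ≠ 0}

variable {K : Type u} [Field K] {n m : ℕ}

lemma mem_bipartiteIdeal_iff {f : MvPolynomial (Fin (n + m)) K} :
    f ∈ bipartiteIdeal K n m ↔ ∀ e ∈ f.support, e ∈ bipartiteExponents n m := by
  have h1 : (Set.range fun i : Fin n => (X (Fin.castAdd m i) : MvPolynomial (Fin (n + m)) K)) =
      X '' Set.range (Fin.castAdd m) := by rw [← Set.range_comp]; rfl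
  have h2 : (Set.range fun j : Fin m => (X (Fin.natAdd n j) : MvPolynomial (Fin (n + m)) K)) =
      X '' Set.range (Fin.natAdd n) := by rw [← Set.range_comp]; rfl
  rw [bipartiteIdeal, Ideal.mem_inf, h1, h2, mem_ideal_span_X_image, mem_ideal_span_X_image,
    ← forall₂_and]
  simp [bipartiteExponents]

variable (K n m) in
/-- The monomial basis of the ideal `(x_1, …, x_n) ∩ (x_{n+1}, …, x_{n+m})`. -/
noncomputable def bipartiteBasis :
    Module.Basis (bipartiteExponents n m) K (bipartiteIdeal K n m) :=
  (basisRestrictSupport K (bipartiteExponents n m)).map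
    { toFun := fun f => ⟨f.1, mem_bipartiteIdeal_iff.2 fun _ he => f.2 he⟩
      invFun := fun f => ⟨f.1, fun _ he => mem_bipartiteIdeal_iff.1 f.2 _ he⟩
      map_add' := fun _ _ => rfl
      map_smul' := fun _ _ => rfl
      left_inv := fun _ => rfl
      right_inv := fun _ => rfl }

@[simp]
lemma bipartiteBasis_repr (f : bipartiteIdeal K n m) (e : bipartiteExponents n m) :
    (bipartiteBasis K n m).repr f e = coeff e.1 (f : MvPolynomial (Fin (n + m)) K) := rfl

lemma mem_comap_restrictSupport_iff (s : Set (Fin (n + m) →₀ ℕ)) (f : bipartiteIdeal K n m) :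
    f ∈ (restrictSupport K s).comap ((bipartiteIdeal K n m).subtype.restrictScalars K) ↔
      ∀ e : bipartiteExponents n m, e.1 ∉ s → (bipartiteBasis K n m).repr f e = 0 := by
  rw [Submodule.mem_comap, mem_restrictSupport_iff]
  constructor
  · intro h e he
    by_contra h0
    exact he (h (mem_support_iff.2 h0))
  · intro h e he
    by_contra h0
    have h1 : e ∈ bipartiteExponents n m := mem_bipartiteIdeal_iff.1 f.2 e he
    exact mem_support_iff.1 he (h ⟨e, h1⟩ h0)

lemma finite_degree_eq (k : ℕ) (j : ℤ) : {e : Fin k →₀ ℕ | (e.degree : ℤ) = j}.Finite := by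
  refine (Finsupp.finite_of_degree_eq (σ := Fin k) j.toNat).subset fun e he => ?_
  have : (e.degree : ℤ) = j := he
  change e.degree = j.toNat
  omega

lemma hilbertSeries_bipartiteIdeal (j : ℤ) :
    hilbertSeries (degreePart (bipartiteIdeal K n m)) j =
      Nat.card {e : bipartiteExponents n m | (e.1.degree : ℤ) = j} := by
  have : Finite {e : bipartiteExponents n m | (e.1.degree : ℤ) = j} :=
    ((finite_degree_eq (n + m) j).preimage Subtype.val_injective.injOn).to_subtype
  exact finrank_eq_card_of_basis (bipartiteBasis K n m) _ _ fun f =>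
    mem_comap_restrictSupport_iff _ f

open PowerSeries in
/-- The generating function of the numbers of monomials in `n` variables is `(1 - X)⁻ⁿ`. -/
lemma coeff_mk_one_pow (n j : ℕ) :
    PowerSeries.coeff j ((PowerSeries.mk 1 : ℤ⟦X⟧) ^ n) =
      (Finset.finsuppAntidiag (Finset.univ : Finset (Fin n)) j).card := by
  have h := PowerSeries.coeff_prod (fun _ : Fin n => (PowerSeries.mk 1 : ℤ⟦X⟧)) j Finset.univ
  simpa using h

lemma mem_finsuppAntidiag_univ_iff {n j : ℕ} {e : Fin n →₀ ℕ} :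
    e ∈ Finset.finsuppAntidiag (Finset.univ : Finset (Fin n)) j ↔ e.degree = j := by
  simp [Finset.mem_finsuppAntidiag, Finsupp.degree_eq_sum]

/-- Splitting off the first `n` of `n + m` exponents. -/
noncomputable def exponentEquiv (n m : ℕ) :
    (Fin (n + m) →₀ ℕ) ≃ (Fin n →₀ ℕ) × (Fin m →₀ ℕ) :=
  (Finsupp.domCongr (M := ℕ) finSumFinEquiv.symm).toEquiv.trans Finsupp.sumFinsuppEquivProdFinsupp

lemma exponentEquiv_fst (e : Fin (n + m) →₀ ℕ) (i : Fin n) :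
    (exponentEquiv n m e).1 i = e (Fin.castAdd m i) := by
  simp [exponentEquiv]

lemma exponentEquiv_snd (e : Fin (n + m) →₀ ℕ) (j : Fin m) :
    (exponentEquiv n m e).2 j = e (Fin.natAdd n j) := by
  simp [exponentEquiv]

lemma degree_exponentEquiv (e : Fin (n + m) →₀ ℕ) :
    e.degree = (exponentEquiv n m e).1.degree + (exponentEquiv n m e).2.degree := by
  simp [Finsupp.degree_eq_sum, Fin.sum_univ_add, exponentEquiv_fst, exponentEquiv_snd]

lemma mem_bipartiteExponents_iff {e : Fin (n + m) →₀ ℕ} :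
    e ∈ bipartiteExponents n m ↔
      (exponentEquiv n m e).1.degree ≠ 0 ∧ (exponentEquiv n m e).2.degree ≠ 0 := by
  simp only [ne_eq, Finsupp.degree_eq_zero_iff, bipartiteExponents, Finsupp.ext_iff,
    exponentEquiv_fst, exponentEquiv_snd, not_forall, Finsupp.coe_zero, Pi.zero_apply]
  rfl

open PowerSeries in
/-- The Hilbert series of `(x_1, …, x_n) ∩ (x_{n+1}, …, x_{n+m})` is
`((1 - X)⁻ⁿ - 1) ((1 - X)⁻ᵐ - 1)`. -/
theorem hilbertSeries_bipartiteIdeal_natCast (j : ℕ) :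
    (hilbertSeries (degreePart (bipartiteIdeal K n m)) j : ℤ) =
      PowerSeries.coeff j
        (((PowerSeries.mk 1 : ℤ⟦X⟧) ^ n - 1) * ((PowerSeries.mk 1 : ℤ⟦X⟧) ^ m - 1)) := by
  classical
  -- Leaving out the zero exponent is what subtracting `1` does to the generating function.
  let A : (k : ℕ) → ℕ → Finset (Fin k →₀ ℕ) := fun k i =>
    if i = 0 then ∅ else Finset.finsuppAntidiag Finset.univ i
  have hA : ∀ k i, PowerSeries.coeff i ((PowerSeries.mk 1 : ℤ⟦X⟧) ^ k - 1) =
      ((A k i).card : ℤ) := by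
    intro k i
    rw [map_sub, coeff_mk_one_pow, PowerSeries.coeff_one]
    by_cases hi : i = 0 <;> simp [A, hi]
  have hmem : ∀ k i (e : Fin k →₀ ℕ), e ∈ (A k i) ↔ e.degree = i ∧ i ≠ 0 := by
    intro k i e
    by_cases hi : i = 0
    · simp [A, hi]
    · simp only [A, hi, if_false, ne_eq, not_false_eq_true, and_true]
      exact mem_finsuppAntidiag_univ_iff
  let T : Finset (Fin (n + m) →₀ ℕ) :=
    (Finset.finsuppAntidiag Finset.univ j).filter (· ∈ bipartiteExponents n m)
  have hT : ∀ e, e ∈ T ↔ e.degree = j ∧ e ∈ bipartiteExponents n m := fun e =>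
    Finset.mem_filter.trans (and_congr_left' mem_finsuppAntidiag_univ_iff)
  have hcard : hilbertSeries (degreePart (bipartiteIdeal K n m)) j = T.card := by
    rw [hilbertSeries_bipartiteIdeal, ← Nat.card_eq_finsetCard T]
    refine Nat.card_congr
      { toFun := fun e => ⟨e.1.1, (hT _).2 ⟨Nat.cast_injective (R := ℤ) e.2, e.1.2⟩⟩
        invFun := fun e => ⟨⟨e.1, ((hT _).1 e.2).2⟩, congrArg Nat.cast ((hT _).1 e.2).1⟩
        left_inv := fun _ => rfl
        right_inv := fun _ => rfl }
  rw [hcard, PowerSeries.coeff_mul]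
  simp only [hA]
  -- A monomial lies in the ideal when both of its bidegrees are nonzero, so counting by bidegree
  -- gives a Cauchy product.
  have hfib : T.card = ∑ p ∈ Finset.HasAntidiagonal.antidiagonal j, (A n p.1).card * (A m p.2).card := by
    rw [Finset.card_eq_sum_card_fiberwise (f := fun e =>
      ((exponentEquiv n m e).1.degree, (exponentEquiv n m e).2.degree))
      (t := Finset.HasAntidiagonal.antidiagonal j)]
    · refine Finset.sum_congr rfl fun p hp => ?_
      rw [← Finset.card_product]
      refine Finset.card_nbij' (exponentEquiv n m) (exponentEquiv n m).symm ?_ ?_ ?_ ?_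
      · intro e he
        obtain ⟨h1, h2⟩ := Finset.mem_filter.1 he
        rw [← h2]
        have h3 := mem_bipartiteExponents_iff.1 ((hT e).1 h1).2
        exact Finset.mem_product.2 ⟨(hmem _ _ _).2 ⟨rfl, h3.1⟩, (hmem _ _ _).2 ⟨rfl, h3.2⟩⟩
      · intro q hq
        obtain ⟨h1, h2⟩ := Finset.mem_product.1 hq
        rw [hmem] at h1 h2
        refine Finset.mem_filter.2 ⟨(hT _).2 ⟨?_, ?_⟩, ?_⟩
        · rw [degree_exponentEquiv, Equiv.apply_symm_apply, h1.1, h2.1]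
          exact Finset.HasAntidiagonal.mem_antidiagonal.1 hp
        · rw [mem_bipartiteExponents_iff, Equiv.apply_symm_apply, h1.1, h2.1]
          exact ⟨h1.2, h2.2⟩
        · rw [Equiv.apply_symm_apply, h1.1, h2.1]
      · intro e _
        exact Equiv.symm_apply_apply _ _
      · intro q _
        exact Equiv.apply_symm_apply _ _
    · intro e he
      refine Finset.mem_coe.2 (Finset.HasAntidiagonal.mem_antidiagonal.2 ?_)
      rw [← degree_exponentEquiv]
      exact ((hT e).1 he).1
  rw [hfib]
  push_cast
  rfl

lemma hilbertSeries_bipartiteIdeal_of_neg {j : ℤ} (hj : j < 0) :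
    hilbertSeries (degreePart (bipartiteIdeal K n m)) j = 0 := by
  rw [hilbertSeries_bipartiteIdeal]
  have : IsEmpty {e : bipartiteExponents n m | (e.1.degree : ℤ) = j} := by
    refine ⟨fun e => ?_⟩
    have : (e.1.1.degree : ℤ) = j := e.2
    omega
  exact Nat.card_of_isEmpty

lemma hilbertSeries_bipartiteIdeal_of_lt_two {j : ℤ} (hj : j < 2) :
    hilbertSeries (degreePart (bipartiteIdeal K n m)) j = 0 := by
  rcases lt_or_ge j 0 with h0 | h0
  · exact hilbertSeries_bipartiteIdeal_of_neg h0
  · obtain ⟨i, rfl⟩ := Int.eq_ofNat_of_zero_le h0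
    have hi : i = 0 ∨ i = 1 := by omega
    refine Nat.cast_injective (R := ℤ) ?_
    rw [hilbertSeries_bipartiteIdeal_natCast, PowerSeries.coeff_mul]
    rcases hi with rfl | rfl <;> simp [Finset.Nat.antidiagonal_succ]

open PowerSeries in
lemma coeff_mk_one_pow_eq_choose (d j : ℕ) :
    PowerSeries.coeff j ((PowerSeries.mk 1 : ℤ⟦X⟧) ^ (d + 1)) = (d + j).choose j := by
  rw [PowerSeries.mk_one_pow_eq_mk_choose_add, PowerSeries.coeff_mk, Nat.choose_symm_add]

lemma hilbertSeries_bipartiteIdeal_two (hn : 1 ≤ n) (hm : 1 ≤ m) :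
    hilbertSeries (degreePart (bipartiteIdeal K n m)) 2 = n * m := by
  obtain ⟨a, rfl⟩ : ∃ a, n = a + 1 := ⟨n - 1, by omega⟩
  obtain ⟨b, rfl⟩ : ∃ b, m = b + 1 := ⟨m - 1, by omega⟩
  refine Nat.cast_injective (R := ℤ) ?_
  rw [show (2 : ℤ) = ((2 : ℕ) : ℤ) from rfl, hilbertSeries_bipartiteIdeal_natCast,
    PowerSeries.coeff_mul]
  simp only [map_sub, coeff_mk_one_pow_eq_choose, PowerSeries.coeff_one]
  simp [Finset.Nat.antidiagonal_succ]

/-- The bidegrees `(1, 2)` and `(2, 1)` contribute `n (m+1 choose 2)` and `m (n+1 choose 2)`. -/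
lemma two_mul_hilbertSeries_bipartiteIdeal_three (hn : 1 ≤ n) (hm : 1 ≤ m) :
    2 * hilbertSeries (degreePart (bipartiteIdeal K n m)) 3 = n * m * (n + m + 2) := by
  obtain ⟨a, rfl⟩ : ∃ a, n = a + 1 := ⟨n - 1, by omega⟩
  obtain ⟨b, rfl⟩ : ∃ b, m = b + 1 := ⟨m - 1, by omega⟩
  have h2 : ∀ d : ℕ, (2 : ℤ) * (d + 2).choose 2 = (d + 2) * (d + 1) := by
    intro d
    have h' : (d + 2) * (d + 1) = 2 * (d + 2).choose 2 := by
      rw [Nat.choose_two_right, Nat.mul_div_cancel']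
      · rfl
      · exact (Nat.even_mul_pred_self (d + 2)).two_dvd
    exact_mod_cast h'.symm
  refine Nat.cast_injective (R := ℤ) ?_
  rw [Nat.cast_mul, show (3 : ℤ) = ((3 : ℕ) : ℤ) from rfl, hilbertSeries_bipartiteIdeal_natCast,
    PowerSeries.coeff_mul]
  simp only [map_sub, coeff_mk_one_pow_eq_choose, PowerSeries.coeff_one]
  simp [Finset.Nat.antidiagonal_succ]
  linear_combination ((b : ℤ) + 1) * h2 a + ((a : ℤ) + 1) * h2 b

end HilbertFunction

/-! ### Upper bounds for Hilbert depth and Stanley depth -/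

section UpperBounds

variable {K : Type u} [Field K] {n m : ℕ}

lemma le_of_mul_le_hilbertSeries_three (hn : 1 ≤ n) (hm : 1 ≤ m) {d : ℕ}
    (h : d * hilbertSeries (degreePart (bipartiteIdeal K n m)) 2 ≤
      hilbertSeries (degreePart (bipartiteIdeal K n m)) 3) : d ≤ (n + m + 2) / 2 := by
  have h2 := hilbertSeries_bipartiteIdeal_two (K := K) hn hm
  have h3 := two_mul_hilbertSeries_bipartiteIdeal_three (K := K) hn hm
  rw [h2] at h
  have hpos : 0 < n * m := Nat.mul_pos hn hm
  have h4 : (n * m) * (2 * d) ≤ (n * m) * (n + m + 2) := by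
    rw [← h3]
    calc (n * m) * (2 * d) = 2 * (d * (n * m)) := by ring
      _ ≤ _ := Nat.mul_le_mul_left 2 h
  have h5 := Nat.le_of_mul_le_mul_left h4 hpos
  omega

theorem hdepth_bipartiteIdeal_le (hn : 1 ≤ n) (hm : 1 ≤ m) :
    hdepth (bipartiteIdeal K n m) ≤ (((n + m + 2) / 2 : ℕ) : ℕ∞) := by
  refine sSup_le ?_
  rintro _ ⟨N, _, _, _, _, 𝒩, hfin, hgr, hser, rfl⟩
  refine iSup₂_le fun rs hrs => ?_
  have hbot : ∀ j < 2, 𝒩 j = ⊥ := by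
    intro j hj
    have := hgr.finite_component j
    rw [← Submodule.finrank_eq_zero (R := K)]
    have h := congrFun hser j
    rwa [hilbertSeries_bipartiteIdeal_of_lt_two hj] at h
  have h : rs.length * Module.finrank K (𝒩 2) ≤ Module.finrank K (𝒩 3) :=
    hgr.length_mul_finrank_le hbot rs hrs.1 hrs.2.toIsWeaklyRegular
  have h2 := congrFun hser 2
  have h3 := congrFun hser 3
  simp only [hilbertSeries] at h2 h3
  rw [h2, h3] at h
  exact Nat.cast_le.2 (le_of_mul_le_hilbertSeries_three (K := K) hn hm h)

lemma mem_stanleySpace_iff {σ : Type*} {M : Type v} [AddCommGroup M] [Module K M]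
    [Module (MvPolynomial σ K) M] [IsScalarTower K (MvPolynomial σ K) M] {x y : M}
    {Z : Finset σ} :
    y ∈ stanleySpace (K := K) x Z ↔ ∃ p ∈ supported K (Z : Set σ), p • x = y :=
  Iff.rfl

lemma mem_bipartiteExponents_add {e : Fin (n + m) →₀ ℕ} (he : e ∈ bipartiteExponents n m)
    (g : Fin (n + m) →₀ ℕ) : e + g ∈ bipartiteExponents n m := by
  obtain ⟨⟨i, hi⟩, ⟨j, hj⟩⟩ := he
  refine ⟨⟨i, ?_⟩, ⟨j, ?_⟩⟩ <;> rw [Finsupp.add_apply] <;> omega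

lemma two_le_degree_of_mem_bipartiteExponents {e : Fin (n + m) →₀ ℕ}
    (he : e ∈ bipartiteExponents n m) : 2 ≤ e.degree := by
  have h := mem_bipartiteExponents_iff.1 he
  have := degree_exponentEquiv e
  omega

lemma mem_supported_iff_support {σ : Type*} {p : MvPolynomial σ K} {Z : Finset σ} :
    p ∈ supported K (Z : Set σ) ↔ ∀ e ∈ p.support, e.support ⊆ Z := by
  rw [mem_supported]
  constructor
  · intro h e he s hs
    exact h (Finset.mem_coe.2 ((mem_vars_iff_mem_support s).2 ⟨e, he, hs⟩))
  · intro h s hs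
    obtain ⟨e, he, hs⟩ := (mem_vars_iff_mem_support s).1 (Finset.mem_coe.1 hs)
    exact h e he hs

namespace StanleyDecomposition

variable (𝒟 : StanleyDecomposition (multidegreePart (bipartiteIdeal K n m)))

/-- A multidegree determines the exponent, so a homogeneous element has at most one term; freeness
makes it nonzero. -/
lemma exists_eq_monomial (i : Fin 𝒟.r) : ∃ e ∈ bipartiteExponents n m, ∃ c : K, c ≠ 0 ∧
    (𝒟.m i : MvPolynomial (Fin (n + m)) K) = monomial e c := by
  obtain ⟨a, ha⟩ := 𝒟.homogeneous i
  have hne : (𝒟.m i : MvPolynomial (Fin (n + m)) K) ≠ 0 := by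
    intro h
    refine one_ne_zero (𝒟.free i 1 (one_mem _) ?_)
    rw [one_smul]
    exact Subtype.ext h
  obtain ⟨e, he⟩ := support_nonempty.2 hne
  have ha' : ((𝒟.m i : MvPolynomial (Fin (n + m)) K).support : Set _) ⊆
    {e : Fin (n + m) →₀ ℕ | ∀ s, (e s : ℤ) = a s} := ha
  refine ⟨e, mem_bipartiteIdeal_iff.1 (𝒟.m i).2 e he, _, mem_support_iff.1 he, ?_⟩
  ext e'
  rw [coeff_monomial]
  split_ifs with h
  · rw [h]
  · by_contra h0
    refine h (Finsupp.ext fun s => ?_)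
    have h1 := ha' he s
    have h2 := ha' (mem_support_iff.2 h0) s
    exact_mod_cast h1.trans h2.symm

/-- The exponent of the monomial generating the `i`-th summand of a Stanley decomposition. -/
noncomputable def exponent (i : Fin 𝒟.r) : Fin (n + m) →₀ ℕ := (𝒟.exists_eq_monomial i).choose

lemma exponent_mem (i : Fin 𝒟.r) : 𝒟.exponent i ∈ bipartiteExponents n m :=
  (𝒟.exists_eq_monomial i).choose_spec.1

lemma exists_coeff (i : Fin 𝒟.r) : ∃ c : K, c ≠ 0 ∧
    (𝒟.m i : MvPolynomial (Fin (n + m)) K) = monomial (𝒟.exponent i) c :=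
  (𝒟.exists_eq_monomial i).choose_spec.2

/-- If no summand contained the monomial with exponent `e`, the coefficient functional at `e` would
vanish on all summands, hence on the whole ideal. -/
lemma exists_add_eq {e : Fin (n + m) →₀ ℕ} (he : e ∈ bipartiteExponents n m) :
    ∃ i, ∃ g : Fin (n + m) →₀ ℕ, g.support ⊆ 𝒟.Z i ∧ 𝒟.exponent i + g = e := by
  by_contra! hcon
  have hle : ∀ i, stanleySpace (K := K) (𝒟.m i) (𝒟.Z i) ≤
      LinearMap.ker ((bipartiteBasis K n m).coord ⟨e, he⟩) := by
    intro i y hy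
    obtain ⟨p, hp, rfl⟩ := mem_stanleySpace_iff.1 hy
    obtain ⟨c, -, hc⟩ := 𝒟.exists_coeff i
    rw [LinearMap.mem_ker, Module.Basis.coord_apply, bipartiteBasis_repr, Submodule.coe_smul,
      smul_eq_mul, hc, coeff_mul_monomial']
    split_ifs with h
    · by_cases h0 : coeff (e - 𝒟.exponent i) p = 0
      · rw [h0, zero_mul]
      · exact absurd (add_tsub_cancel_of_le h) (hcon i _
          (mem_supported_iff_support.1 hp _ (mem_support_iff.2 h0)))
    · rfl
  have htop := 𝒟.isInternal.submodule_iSup_eq_top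
  have h1 : (⊤ : Submodule K (bipartiteIdeal K n m)) ≤
      LinearMap.ker ((bipartiteBasis K n m).coord ⟨e, he⟩) := htop ▸ iSup_le hle
  have h2 := h1 (Submodule.mem_top (x := bipartiteBasis K n m ⟨e, he⟩))
  rw [LinearMap.mem_ker, Module.Basis.coord_apply, Module.Basis.repr_self,
    Finsupp.single_eq_same] at h2
  exact one_ne_zero h2

/-- A monomial reached from two different generators would lie, up to a scalar, in two independent
summands. The scalar `c / c'` in the proof equalizes the two leading coefficients. -/
lemma eq_of_add_eq_add {i j : Fin 𝒟.r} {g g' : Fin (n + m) →₀ ℕ} (hg : g.support ⊆ 𝒟.Z i)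
    (hg' : g'.support ⊆ 𝒟.Z j) (h : 𝒟.exponent i + g = 𝒟.exponent j + g') : i = j := by
  by_contra hij
  obtain ⟨c, hc, hmc⟩ := 𝒟.exists_coeff i
  obtain ⟨c', hc', hmc'⟩ := 𝒟.exists_coeff j
  have hsupp : ∀ (a : K) (g : Fin (n + m) →₀ ℕ) (Z : Finset (Fin (n + m))), g.support ⊆ Z →
      monomial g a ∈ supported K (Z : Set (Fin (n + m))) := by
    intro a g Z hg
    rw [mem_supported_iff_support]
    intro e he
    rw [Finset.mem_singleton.1 (support_monomial_subset he)]
    exact hg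
  have hdisj := 𝒟.isInternal.submodule_iSupIndep.pairwiseDisjoint hij
  have h1 : monomial g (1 : K) • 𝒟.m i ∈ stanleySpace (K := K) (𝒟.m i) (𝒟.Z i) :=
    mem_stanleySpace_iff.2 ⟨_, hsupp 1 g _ hg, rfl⟩
  have h2 : monomial g' (c / c') • 𝒟.m j ∈ stanleySpace (K := K) (𝒟.m j) (𝒟.Z j) :=
    mem_stanleySpace_iff.2 ⟨_, hsupp _ g' _ hg', rfl⟩
  have h3 : monomial g (1 : K) • 𝒟.m i = monomial g' (c / c') • 𝒟.m j := by
    refine Subtype.ext ?_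
    rw [Submodule.coe_smul, Submodule.coe_smul, hmc, hmc', smul_eq_mul, smul_eq_mul,
      monomial_mul, monomial_mul, one_mul, div_mul_cancel₀ _ hc', add_comm g, h, add_comm g']
  have h4 := Submodule.disjoint_def.1 hdisj _ h1 (h3 ▸ h2)
  have h5 := 𝒟.free i _ (hsupp 1 g _ hg) h4
  rw [monomial_eq_zero] at h5
  exact one_ne_zero h5

/-- If all sets of variables in a Stanley decomposition have at least `d` elements, then so many
elements of degree three are obtained from each monomial of degree two. -/
lemma mul_hilbertSeries_le {d : ℕ} (hd : ∀ i, d ≤ (𝒟.Z i).card) :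
    d * hilbertSeries (degreePart (bipartiteIdeal K n m)) 2 ≤
      hilbertSeries (degreePart (bipartiteIdeal K n m)) 3 := by
  rw [hilbertSeries_bipartiteIdeal, hilbertSeries_bipartiteIdeal]
  -- All generators have degree at least 2, so a monomial of degree 2 can only occur as the
  -- generator of its summand.
  have hex : ∀ e : {e : bipartiteExponents n m | (e.1.degree : ℤ) = 2},
      ∃ i, 𝒟.exponent i = e.1.1 := by
    intro e
    obtain ⟨i, g, -, h⟩ := 𝒟.exists_add_eq e.1.2
    have h1 : (e.1.1.degree : ℤ) = 2 := e.2
    have h2 := two_le_degree_of_mem_bipartiteExponents (𝒟.exponent_mem i)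
    have h3 : (𝒟.exponent i).degree + g.degree = e.1.1.degree := by rw [← h, map_add]
    have h4 : g = 0 := (Finsupp.degree_eq_zero_iff g).1 (by omega)
    exact ⟨i, by rw [← h, h4, add_zero]⟩
  choose ix hix using hex
  have : Finite {e : bipartiteExponents n m | (e.1.degree : ℤ) = 3} :=
    ((finite_degree_eq (n + m) 3).preimage Subtype.val_injective.injOn).to_subtype
  rw [← Nat.card_fin d, ← Nat.card_prod]
  let η : ∀ i, Fin d ↪o Fin (n + m) := fun i => (𝒟.Z i).orderEmbOfCardLe (hd i)
  have hη : ∀ i t, (Finsupp.single (η i t) 1 : Fin (n + m) →₀ ℕ).support ⊆ 𝒟.Z i := fun i t =>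
    Finsupp.support_single_subset.trans
      (Finset.singleton_subset_iff.2 (Finset.orderEmbOfCardLe_mem _ _ _))
  refine Nat.card_le_card_of_injective
    (fun p => ⟨⟨p.2.1.1 + Finsupp.single (η (ix p.2) p.1) 1,
      mem_bipartiteExponents_add p.2.1.2 _⟩, ?_⟩) ?_
  · change ((p.2.1.1 + Finsupp.single (η (ix p.2) p.1) 1).degree : ℤ) = 3
    have h1 : (p.2.1.1.degree : ℤ) = 2 := p.2.2
    rw [map_add, Finsupp.degree_single]
    push_cast
    omega
  · rintro ⟨t, e⟩ ⟨t', e'⟩ h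
    have h1 : e.1.1 + Finsupp.single (η (ix e) t) 1 = e'.1.1 + Finsupp.single (η (ix e') t') 1 :=
      congrArg (fun x => x.1.1) h
    have h2 : ix e = ix e' := 𝒟.eq_of_add_eq_add (hη _ t) (hη _ t') (by rw [hix, hix, h1])
    have h3 : e = e' := by
      refine Subtype.ext (Subtype.ext ?_)
      rw [← hix, ← hix, h2]
    subst h3
    have h4 := Finsupp.single_left_injective one_ne_zero (add_left_cancel h1)
    rw [(η (ix e)).injective h4]

end StanleyDecomposition

theorem sdepth_bipartiteIdeal_le (hn : 1 ≤ n) (hm : 1 ≤ m) :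
    sdepth (bipartiteIdeal K n m) ≤ (((n + m + 2) / 2 : ℕ) : ℕ∞) := by
  refine iSup_le fun 𝒟 => ?_
  by_contra! hlt
  -- For an empty decomposition, where the infimum is `⊤`, this holds vacuously and the count below
  -- still gives the contradiction.
  have hcard : ∀ i, (n + m + 2) / 2 + 1 ≤ (𝒟.Z i).card := by
    intro i
    have h := hlt.trans_le (iInf_le (fun i => ((𝒟.Z i).card : ℕ∞)) i)
    exact Nat.cast_lt.1 h
  have := le_of_mul_le_hilbertSeries_three hn hm (𝒟.mul_hilbertSeries_le hcard)
  omega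

end UpperBounds

/-! ### Polynomial rings in fewer variables as modules -/

section TruncatedPolynomials

/-- The polynomial ring in the first `d` of `k` variables, as a module over the polynomial ring
in all `k` variables, on which the other variables act as zero. -/
def TruncPoly (K : Type u) [Field K] (_k d : ℕ) : Type u := MvPolynomial (Fin d) K

variable {K : Type u} [Field K] {k d : ℕ}

noncomputable instance : AddCommGroup (TruncPoly K k d) :=
  inferInstanceAs (AddCommGroup (MvPolynomial (Fin d) K))

noncomputable instance : Module K (TruncPoly K k d) :=
  inferInstanceAs (Module K (MvPolynomial (Fin d) K))

variable (K k d) in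
/-- The quotient map setting all but the first `d` variables to zero. -/
noncomputable def truncHom : MvPolynomial (Fin k) K →ₐ[K] MvPolynomial (Fin d) K :=
  aeval fun s => if h : (s : ℕ) < d then X ⟨s, h⟩ else 0

noncomputable instance : Module (MvPolynomial (Fin k) K) (TruncPoly K k d) :=
  Module.compHom (MvPolynomial (Fin d) K) (truncHom K k d).toRingHom

/-- The underlying polynomial. -/
noncomputable def TruncPoly.toPoly : TruncPoly K k d ≃ₗ[K] MvPolynomial (Fin d) K :=
  LinearEquiv.refl K _

lemma TruncPoly.toPoly_smul (p : MvPolynomial (Fin k) K) (f : TruncPoly K k d) :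
    (p • f).toPoly = truncHom K k d p * f.toPoly := rfl

lemma truncHom_X {s : Fin k} (h : (s : ℕ) < d) : truncHom K k d (X s) = X ⟨s, h⟩ := by
  rw [truncHom, aeval_X, dif_pos h]

lemma truncHom_isHomogeneous {p : MvPolynomial (Fin k) K} {i : ℕ} (hp : p.IsHomogeneous i) :
    (truncHom K k d p).IsHomogeneous i := by
  have h := hp.aeval (fun s : Fin k => if h : (s : ℕ) < d then (X ⟨s, h⟩ : MvPolynomial (Fin d) K)
    else 0) (n := 1) (fun s => by
      split_ifs
      · exact isHomogeneous_X _ _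
      · exact isHomogeneous_zero _ _ _)
  rwa [one_mul] at h

lemma truncHom_surjective (hd : d ≤ k) : Function.Surjective (truncHom K k d) := by
  intro p
  refine ⟨rename (Fin.castLE hd) p, ?_⟩
  rw [truncHom, aeval_rename]
  have : (fun s : Fin k => if h : (s : ℕ) < d then (X ⟨s, h⟩ : MvPolynomial (Fin d) K)
    else 0) ∘ Fin.castLE hd = X := by
    ext1 s
    simp
  rw [this, aeval_X_left_apply]

instance : IsScalarTower K (MvPolynomial (Fin k) K) (TruncPoly K k d) where
  smul_assoc c p f := TruncPoly.toPoly.injective <| by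
    rw [TruncPoly.toPoly_smul, map_smul, map_smul, TruncPoly.toPoly_smul, smul_mul_assoc]

lemma TruncPoly.finite (hd : d ≤ k) : Module.Finite (MvPolynomial (Fin k) K) (TruncPoly K k d) := by
  let f : MvPolynomial (Fin k) K →ₗ[MvPolynomial (Fin k) K] TruncPoly K k d :=
    LinearMap.toSpanSingleton _ _ (TruncPoly.toPoly.symm 1)
  refine Module.Finite.of_surjective f fun y => ?_
  obtain ⟨p, hp⟩ := truncHom_surjective hd y.toPoly
  refine ⟨p, TruncPoly.toPoly.injective ?_⟩
  rw [LinearMap.toSpanSingleton_apply, TruncPoly.toPoly_smul, LinearEquiv.apply_symm_apply, mul_one,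
    hp]

end TruncatedPolynomials

/-! ### Direct sums of shifted polynomial rings and their depth -/

section TruncatedSums

variable {K : Type u} [Field K] {k : ℕ} {ι : Type} (a d : ι → ℕ)

/-- The degree `j` component of a direct sum of shifted truncated polynomial rings. -/
def truncGrading (K : Type u) [Field K] (k : ℕ) (a d : ι → ℕ) (j : ℤ) :
    Submodule K (∀ i, TruncPoly K k (d i)) where
  carrier := {f | ∀ i e, (e.degree : ℤ) + a i ≠ j → coeff e (f i).toPoly = 0}
  zero_mem' i e _ := by rw [Pi.zero_apply, map_zero, coeff_zero]
  add_mem' hf hg i e h := by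
    rw [Pi.add_apply, map_add, coeff_add, hf i e h, hg i e h, add_zero]
  smul_mem' c f hf i e h := by rw [Pi.smul_apply, map_smul, coeff_smul, hf i e h, smul_zero]

lemma mem_truncGrading {j : ℤ} {f : ∀ i, TruncPoly K k (d i)} :
    f ∈ truncGrading K k a d j ↔
      ∀ i e, (e.degree : ℤ) + a i ≠ j → coeff e (f i).toPoly = 0 := Iff.rfl

variable [Fintype ι]

/-- The monomial basis of a direct sum of truncated polynomial rings. -/
noncomputable def truncBasis (K : Type u) [Field K] (k : ℕ) (d : ι → ℕ) :
    Module.Basis (Σ i, Fin (d i) →₀ ℕ) K (∀ i, TruncPoly K k (d i)) :=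
  Pi.basis fun i => (basisMonomials (Fin (d i)) K).map TruncPoly.toPoly.symm

lemma truncBasis_repr (f : ∀ i, TruncPoly K k (d i)) (p : Σ i, Fin (d i) →₀ ℕ) :
    (truncBasis K k d).repr f p = coeff p.2 (f p.1).toPoly := by
  rw [truncBasis, Pi.basis_repr]
  rfl

lemma isGradedModule_truncGrading :
    IsGradedModule (σ := Fin k) (truncGrading K k a d) where
  isInternal := by
    refine isInternal_of_basis (truncBasis K k d) (fun p => (p.2.degree : ℤ) + a p.1) _
      fun j f => ?_
    simp only [truncBasis_repr, mem_truncGrading]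
    exact ⟨fun h p => h p.1 p.2, fun h i e => h ⟨i, e⟩⟩
  smul_mem := by
    classical
    intro i j p f hp hf l e he
    rw [Pi.smul_apply, TruncPoly.toPoly_smul, coeff_mul]
    refine Finset.sum_eq_zero fun x hx => ?_
    have hx' := Finset.HasAntidiagonal.mem_antidiagonal.1 hx
    by_contra h0
    have h1 := left_ne_zero_of_mul h0
    have h2 := right_ne_zero_of_mul h0
    have h3 : x.1.degree = i := by
      by_contra h
      exact h1 ((truncHom_isHomogeneous hp).coeff_eq_zero h)
    have h4 : (x.2.degree : ℤ) + a l = j := by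
      by_contra h
      exact h2 (hf l x.2 h)
    refine he ?_
    rw [← hx', map_add, h3, ← h4]
    push_cast
    ring

lemma hilbertSeries_truncGrading (j : ℤ) :
    hilbertSeries (truncGrading K k a d) j =
      ∑ i, Nat.card {e : Fin (d i) →₀ ℕ | (e.degree : ℤ) + a i = j} := by
  have hfin : ∀ i, Finite {e : Fin (d i) →₀ ℕ | (e.degree : ℤ) + a i = j} := fun i =>
    ((finite_degree_eq (d i) (j - a i)).subset fun e (he : _ = _) =>
      (by rw [← he]; ring : (e.degree : ℤ) = j - a i)).to_subtype
  let s : Set (Σ i, Fin (d i) →₀ ℕ) := {p | (p.2.degree : ℤ) + a p.1 = j}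
  let E : s ≃ Σ i, {e : Fin (d i) →₀ ℕ | (e.degree : ℤ) + a i = j} :=
    { toFun := fun p => ⟨p.1.1, p.1.2, p.2⟩
      invFun := fun p => ⟨⟨p.1, p.2.1⟩, p.2.2⟩
      left_inv := fun _ => rfl
      right_inv := fun _ => rfl }
  have : Finite s := Finite.of_equiv _ E.symm
  rw [← Nat.card_sigma, ← Nat.card_congr E]
  refine finrank_eq_card_of_basis (truncBasis K k d) s _ fun f => ?_
  simp only [truncBasis_repr, mem_truncGrading]
  exact ⟨fun h p => h p.1 p.2, fun h i e => h ⟨i, e⟩⟩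

open PowerSeries in
lemma hilbertSeries_truncGrading_natCast (j : ℕ) :
    (hilbertSeries (truncGrading K k a d) j : ℤ) =
      PowerSeries.coeff j (∑ i, (PowerSeries.X : ℤ⟦X⟧) ^ a i * (PowerSeries.mk 1) ^ d i) := by
  rw [hilbertSeries_truncGrading, map_sum, Nat.cast_sum]
  refine Finset.sum_congr rfl fun i _ => ?_
  rw [PowerSeries.coeff_X_pow_mul']
  split_ifs with h
  · rw [coeff_mk_one_pow, ← Nat.card_eq_finsetCard]
    congr 1
    refine Nat.card_congr (Equiv.subtypeEquivRight fun e => ?_)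
    rw [mem_finsuppAntidiag_univ_iff]
    change (e.degree : ℤ) + a i = j ↔ _
    omega
  · have : IsEmpty {e : Fin (d i) →₀ ℕ | (e.degree : ℤ) + a i = j} := by
      refine ⟨fun e => ?_⟩
      have : (e.1.degree : ℤ) + a i = j := e.2
      omega
    rw [Nat.card_of_isEmpty, Nat.cast_zero]

lemma hilbertSeries_truncGrading_of_neg {j : ℤ} (hj : j < 0) :
    hilbertSeries (truncGrading K k a d) j = 0 := by
  rw [hilbertSeries_truncGrading]
  refine Finset.sum_eq_zero fun i _ => ?_
  have : IsEmpty {e : Fin (d i) →₀ ℕ | (e.degree : ℤ) + a i = j} := by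
    refine ⟨fun e => ?_⟩
    have : (e.1.degree : ℤ) + a i = j := e.2
    omega
  exact Nat.card_of_isEmpty

variable {d} {q : ℕ}

variable (K) in
/-- The first `q` of `k` variables. -/
noncomputable def initialVariables (hqk : q ≤ k) : List (MvPolynomial (Fin k) K) :=
  List.ofFn fun t : Fin q => X (Fin.castLE hqk t)

/-- As `q ≤ d i`, the first `t` variables act as variables on every summand, so they generate the
tuples all of whose monomials involve one of them. This turns regularity into a statement about
coefficients. -/
lemma mem_ofList_take_smul_top_iff [DecidableEq ι] (hqk : q ≤ k) (hd : ∀ i, q ≤ d i) {t : ℕ}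
    (ht : t ≤ q) (f : ∀ i, TruncPoly K k (d i)) :
    f ∈ (Ideal.ofList ((initialVariables K hqk).take t) • ⊤ :
      Submodule (MvPolynomial (Fin k) K) (∀ i, TruncPoly K k (d i))) ↔
      ∀ i (e : Fin (d i) →₀ ℕ), (∀ s : Fin (d i), (s : ℕ) < t → e s = 0) →
        coeff e (f i).toPoly = 0 := by
  have htake : ∀ p, p ∈ (initialVariables K hqk).take t ↔
      ∃ s : Fin q, (s : ℕ) < t ∧ p = X (Fin.castLE hqk s) := by
    intro p
    rw [List.mem_take_iff_getElem]
    simp only [initialVariables, List.length_ofFn, List.getElem_ofFn]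
    constructor
    · rintro ⟨i, hi, rfl⟩
      exact ⟨⟨i, by omega⟩, by simp only; omega, rfl⟩
    · rintro ⟨s, hs, rfl⟩
      exact ⟨s, by have := s.2; omega, rfl⟩
  constructor
  · intro hf
    refine Submodule.smul_induction_on hf (fun r hr y _ => ?_) (fun x y hx hy i e h => by
      rw [Pi.add_apply, map_add, coeff_add, hx i e h, hy i e h, add_zero])
    refine Submodule.span_induction (p := fun r _ => ∀ y : (∀ i, TruncPoly K k (d i)),
      ∀ i (e : Fin (d i) →₀ ℕ), (∀ s : Fin (d i), (s : ℕ) < t → e s = 0) →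
        coeff e ((r • y) i).toPoly = 0) ?_ ?_ ?_ ?_ hr y
    · intro p hp y i e h
      obtain ⟨s, hs, rfl⟩ := (htake p).1 hp
      have hsd : (s : ℕ) < d i := s.2.trans_le (hd i)
      rw [Pi.smul_apply, TruncPoly.toPoly_smul,
        truncHom_X (s := Fin.castLE hqk s) (d := d i) (by simpa using hsd), coeff_X_mul', if_neg]
      rw [Finsupp.notMem_support_iff]
      exact h _ hs
    · intro y i e _
      rw [zero_smul, Pi.zero_apply, map_zero, coeff_zero]
    · intro p p' _ _ hp hp' y i e h
      rw [add_smul, Pi.add_apply, map_add, coeff_add, hp y i e h, hp' y i e h, add_zero]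
    · intro c p _ hp y i e h
      rw [smul_eq_mul, mul_comm, mul_smul]
      exact hp _ i e h
  · intro hf
    let g : ∀ i, (Fin (d i) →₀ ℕ) → ∀ i, TruncPoly K k (d i) := fun i e =>
      Pi.single i (TruncPoly.toPoly.symm (monomial e (coeff e (f i).toPoly)))
    -- Split `f` into single terms; each is divisible by one of the first `t` variables.
    have hsum : f = ∑ i, ∑ e ∈ (f i).toPoly.support, g i e := by
      have h1 : ∀ i, ∑ e ∈ (f i).toPoly.support, g i e = Pi.single i (f i) := by
        intro i
        have h2 : f i = TruncPoly.toPoly.symm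
            (∑ e ∈ (f i).toPoly.support, monomial e (coeff e (f i).toPoly)) := by
          rw [support_sum_monomial_coeff, LinearEquiv.symm_apply_apply]
        conv_rhs => rw [h2, map_sum]
        exact (map_sum (AddMonoidHom.single (fun i => TruncPoly K k (d i)) i) _ _).symm
      rw [Finset.sum_congr rfl fun i _ => h1 i]
      exact (Finset.univ_sum_single f).symm
    rw [hsum]
    refine Submodule.sum_mem _ fun i _ => Submodule.sum_mem _ fun e he => ?_
    obtain ⟨s, hs, hes⟩ : ∃ s : Fin (d i), (s : ℕ) < t ∧ e s ≠ 0 := by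
      by_contra! h
      exact mem_support_iff.1 he (hf i e h)
    have hsq : (s : ℕ) < q := by omega
    have h2 : (TruncPoly.toPoly (k := k)).symm (monomial e (coeff e (f i).toPoly)) =
        (X (Fin.castLE hqk ⟨s, hsq⟩) : MvPolynomial (Fin k) K) • TruncPoly.toPoly.symm
          (monomial (e - Finsupp.single s 1) (coeff e (f i).toPoly)) := by
      refine (TruncPoly.toPoly (K := K) (k := k) (d := d i)).injective ?_
      rw [TruncPoly.toPoly_smul, LinearEquiv.apply_symm_apply, LinearEquiv.apply_symm_apply,
        truncHom_X (s := Fin.castLE hqk ⟨s, hsq⟩) (d := d i) (by simp)]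
      change _ = monomial (Finsupp.single s 1) 1 * _
      rw [monomial_mul, one_mul, add_tsub_cancel_of_le]
      rw [Finsupp.single_le_iff]
      exact Nat.one_le_iff_ne_zero.2 hes
    have h1 : g i e = (X (Fin.castLE hqk ⟨s, hsq⟩) : MvPolynomial (Fin k) K) •
        (Pi.single i (TruncPoly.toPoly.symm
          (monomial (e - Finsupp.single s 1) (coeff e (f i).toPoly))) :
          ∀ i, TruncPoly K k (d i)) := by
      rw [← Pi.single_smul, ← h2]
    rw [h1]
    exact Submodule.smul_mem_smul (Ideal.subset_span ((htake _).2 ⟨⟨s, hsq⟩, hs, rfl⟩)) trivial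

open RingTheory.Sequence in
lemma isRegular_initialVariables [Nonempty ι] (hqk : q ≤ k) (hd : ∀ i, q ≤ d i) :
    IsRegular (∀ i, TruncPoly K k (d i)) (initialVariables K hqk) := by
  classical
  have hlen : (initialVariables K hqk).length = q := by simp [initialVariables]
  refine ⟨⟨fun t ht => ?_⟩, fun h => ?_⟩
  · rw [hlen] at ht
    rw [isSMulRegular_quotient_iff_mem_of_smul_mem]
    intro f hf
    rw [mem_ofList_take_smul_top_iff hqk hd ht.le] at hf ⊢
    intro i e he
    have hX : (initialVariables K hqk)[t] = X (Fin.castLE hqk ⟨t, ht⟩) := by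
      simp [initialVariables]
    have htd : t < d i := ht.trans_le (hd i)
    have h1 := hf i (Finsupp.single ⟨t, htd⟩ 1 + e) (fun s hs => by
      rw [Finsupp.add_apply, he s hs, add_zero, Finsupp.single_apply, if_neg]
      rintro rfl
      exact lt_irrefl _ hs)
    rw [hX, Pi.smul_apply, TruncPoly.toPoly_smul,
      truncHom_X (s := Fin.castLE hqk ⟨t, ht⟩) (d := d i) (by simpa using htd)] at h1
    exact (coeff_X_mul e ⟨t, htd⟩ (f i).toPoly).symm.trans h1
  -- The quotient by all `q` variables is nonzero, because the tuple of ones has nonzero constant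
  -- terms.
  · obtain ⟨i⟩ := ‹Nonempty ι›
    let f : ∀ i, TruncPoly K k (d i) := fun i => TruncPoly.toPoly.symm 1
    have hf : f ∈ (Ideal.ofList (initialVariables K hqk) • ⊤ :
        Submodule (MvPolynomial (Fin k) K) (∀ i, TruncPoly K k (d i))) := h ▸ Submodule.mem_top
    rw [← List.take_length (l := initialVariables K hqk),
      mem_ofList_take_smul_top_iff hqk hd hlen.le] at hf
    have h1 := hf i 0 (fun _ _ => rfl)
    simp [f] at h1

open PowerSeries in
/-- If the Hilbert series of `M` is a nonempty sum of series `X ^ a / (1 - X) ^ d` with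
`q ≤ d ≤ k`, then `M` has Hilbert depth at least `q` over a polynomial ring in `k` variables. -/
theorem le_hilbertDepth_of_sum_eq [Nonempty ι] {M : Type v} [AddCommGroup M] [Module K M]
    (ℳ : ℤ → Submodule K M) (hd : ∀ i, q ≤ d i) (hdk : ∀ i, d i ≤ k)
    (hneg : ∀ j < 0, hilbertSeries ℳ j = 0)
    (hser : ∀ j : ℕ, (hilbertSeries ℳ j : ℤ) =
      PowerSeries.coeff j (∑ i, (PowerSeries.X : ℤ⟦X⟧) ^ a i * (PowerSeries.mk 1) ^ d i)) :
    (q : ℕ∞) ≤ hilbertDepth k ℳ := by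
  have hqk : q ≤ k := (hd (Classical.arbitrary ι)).trans (hdk _)
  have hfin : Module.Finite (MvPolynomial (Fin k) K) (∀ i, TruncPoly K k (d i)) := by
    have := fun i => TruncPoly.finite (K := K) (hdk i)
    exact Module.Finite.pi
  have hdepth : (q : ℕ∞) ≤ depth K (Fin k) (∀ i, TruncPoly K k (d i)) := by
    refine le_trans (le_of_eq ?_) (le_iSup₂ (f := fun (rs : List (MvPolynomial (Fin k) K)) _ =>
      (rs.length : ℕ∞)) (initialVariables K hqk) ⟨?_, isRegular_initialVariables hqk hd⟩)
    · simp [initialVariables]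
    · intro f hf
      obtain ⟨t, rfl⟩ := (List.mem_ofFn' _ _).1 hf
      exact Ideal.subset_span ⟨_, rfl⟩
  refine hdepth.trans (le_sSup ⟨_, inferInstance, inferInstance, inferInstance, inferInstance,
    truncGrading K k a d, hfin, isGradedModule_truncGrading a d, funext fun j => ?_, rfl⟩)
  rcases lt_or_ge j 0 with hj | hj
  · rw [hneg j hj, hilbertSeries_truncGrading_of_neg a d hj]
  · obtain ⟨j, rfl⟩ := Int.eq_ofNat_of_zero_le hj
    refine Nat.cast_injective (R := ℤ) ?_
    rw [hser, hilbertSeries_truncGrading_natCast]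

end TruncatedSums

/-! ### Decomposing the Hilbert series -/

section HilbertDecompositions

open PowerSeries (mk)

/-- The sums of the power series `X ^ a / (1 - X) ^ d` with `q ≤ d ≤ k`. -/
noncomputable def hilbertCone (q k : ℕ) : AddSubmonoid (PowerSeries ℤ) :=
  AddSubmonoid.closure {f | ∃ a d, q ≤ d ∧ d ≤ k ∧ f = PowerSeries.X ^ a * mk 1 ^ d}

lemma mem_hilbertCone {q k d : ℕ} (a : ℕ) (hq : q ≤ d) (hk : d ≤ k) :
    PowerSeries.X ^ a * mk 1 ^ d ∈ hilbertCone q k :=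
  AddSubmonoid.subset_closure ⟨a, d, hq, hk, rfl⟩

lemma mul_mem_hilbertCone {q k q' k' a e : ℕ} (hq : q' ≤ q + e) (hk : k + e ≤ k')
    {f : PowerSeries ℤ} (hf : f ∈ hilbertCone q k) :
    PowerSeries.X ^ a * mk 1 ^ e * f ∈ hilbertCone q' k' := by
  induction hf using AddSubmonoid.closure_induction with
  | mem f hf =>
    obtain ⟨b, d, hd, hdk, rfl⟩ := hf
    have h : PowerSeries.X ^ a * mk 1 ^ e * (PowerSeries.X ^ b * mk 1 ^ d) =
        (PowerSeries.X ^ (a + b) * mk 1 ^ (e + d) : PowerSeries ℤ) := by ring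
    rw [h]
    exact mem_hilbertCone _ (by omega) (by omega)
  | zero => rw [mul_zero]; exact zero_mem _
  | add f g _ _ hf hg => rw [mul_add]; exact add_mem hf hg

lemma X_mul_mk_one : (PowerSeries.X : PowerSeries ℤ) * mk 1 = mk 1 - 1 := by
  have h := PowerSeries.mk_one_mul_one_sub_eq_one ℤ
  linear_combination -h

/-- With `h = 1 / (1 - X)` and `u = X ^ 2 * h`, the series `(h ^ (2 * i + 1) - 1) / (X h ^ (i + 1))`
and `(h ^ (2 * i) + 1) / h ^ i` are sums of powers `u ^ j` with `j ≤ i`. -/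
lemma exists_sum_of_powers (i : ℕ) :
    ∃ U ∈ AddSubmonoid.closure
        {f : PowerSeries ℤ | ∃ j ≤ i, f = (PowerSeries.X ^ 2 * mk 1) ^ j},
      ∃ W ∈ AddSubmonoid.closure
        {f : PowerSeries ℤ | ∃ j ≤ i, f = (PowerSeries.X ^ 2 * mk 1) ^ j},
      PowerSeries.X * mk 1 ^ (i + 1) * U = mk 1 ^ (2 * i + 1) - 1 ∧
        mk 1 ^ i * W = mk 1 ^ (2 * i) + 1 := by
  have hX := X_mul_mk_one
  induction i with
  | zero =>
    have h1 : (1 : PowerSeries ℤ) ∈ AddSubmonoid.closure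
        {f : PowerSeries ℤ | ∃ j ≤ 0, f = (PowerSeries.X ^ 2 * mk 1) ^ j} :=
      AddSubmonoid.subset_closure ⟨0, le_rfl, by rw [pow_zero]⟩
    refine ⟨1, h1, 1 + 1, add_mem h1 h1, ?_, by ring⟩
    rw [mul_one, zero_add, pow_one, hX]
  | succ i ih =>
    -- Since `u = h - 2 + h⁻¹`, the two series are the palindromic sums `U_i = h⁻ⁱ + ⋯ + hⁱ` and
    -- `W_i = hⁱ + h⁻ⁱ`. They satisfy the subtraction-free recursion `W_{i+1} = W_i + u U_i`,
    -- `U_{i+1} = U_i + W_{i+1}`.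
    obtain ⟨U, hU, W, hW, hUe, hWe⟩ := ih
    have hmono : ∀ f ∈ AddSubmonoid.closure
        {f : PowerSeries ℤ | ∃ j ≤ i, f = (PowerSeries.X ^ 2 * mk 1) ^ j},
        f ∈ AddSubmonoid.closure
          {f : PowerSeries ℤ | ∃ j ≤ i + 1, f = (PowerSeries.X ^ 2 * mk 1) ^ j} ∧
        PowerSeries.X ^ 2 * mk 1 * f ∈ AddSubmonoid.closure
          {f : PowerSeries ℤ | ∃ j ≤ i + 1, f = (PowerSeries.X ^ 2 * mk 1) ^ j} := by
      intro f hf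
      induction hf using AddSubmonoid.closure_induction with
      | mem f hf =>
        obtain ⟨j, hj, rfl⟩ := hf
        exact ⟨AddSubmonoid.subset_closure ⟨j, by omega, rfl⟩,
          AddSubmonoid.subset_closure ⟨j + 1, by omega, by ring⟩⟩
      | zero => exact ⟨zero_mem _, by rw [mul_zero]; exact zero_mem _⟩
      | add f g _ _ hf hg => exact ⟨add_mem hf.1 hg.1, by rw [mul_add]; exact add_mem hf.2 hg.2⟩
    have hW' := add_mem (hmono W hW).1 (hmono U hU).2
    have hWe' : mk 1 ^ (i + 1) * (W + PowerSeries.X ^ 2 * mk 1 * U) =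
        (mk 1 ^ (2 * (i + 1)) + 1 : PowerSeries ℤ) := by
      linear_combination mk 1 * hWe + PowerSeries.X * mk 1 * hUe + (mk 1 ^ (2 * i + 1) - 1) * hX
    refine ⟨U + (W + PowerSeries.X ^ 2 * mk 1 * U), add_mem (hmono U hU).1 hW', _, hW', ?_, hWe'⟩
    linear_combination mk 1 * hUe + PowerSeries.X * mk 1 * hWe' + (mk 1 ^ (2 * i + 2) + 1) * hX

/-- For `c = 2i + 1`, the series is a sum of terms `X h^(i+1) u^j = X^(2j+1) h^(i+1+j)` with `j ≤
i`. For even `c > 0`, use `h^c - 1 = (h^(c-1) - 1) + X h^c`. -/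
lemma mk_one_pow_sub_one_mem_hilbertCone (c : ℕ) :
    mk 1 ^ c - 1 ∈ hilbertCone ((c + 1) / 2) c := by
  have hodd : ∀ i : ℕ, mk 1 ^ (2 * i + 1) - 1 ∈ hilbertCone (i + 1) (2 * i + 1) := by
    intro i
    obtain ⟨U, hU, -, -, hUe, -⟩ := exists_sum_of_powers i
    rw [← hUe]
    clear hUe
    induction hU using AddSubmonoid.closure_induction with
    | mem f hf =>
      obtain ⟨j, hj, rfl⟩ := hf
      have h : PowerSeries.X * mk 1 ^ (i + 1) * (PowerSeries.X ^ 2 * mk 1) ^ j =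
          (PowerSeries.X ^ (2 * j + 1) * mk 1 ^ (i + 1 + j) : PowerSeries ℤ) := by ring
      rw [h]
      exact mem_hilbertCone _ (by omega) (by omega)
    | zero => rw [mul_zero]; exact zero_mem _
    | add f g _ _ hf hg => rw [mul_add]; exact add_mem hf hg
  obtain ⟨i, rfl | rfl⟩ := Nat.even_or_odd' c
  · cases i with
    | zero => rw [mul_zero, pow_zero, sub_self]; exact zero_mem _
    | succ i =>
      have h : (mk 1 ^ (2 * (i + 1)) - 1 : PowerSeries ℤ) =
          PowerSeries.X ^ 0 * mk 1 ^ 0 * (mk 1 ^ (2 * i + 1) - 1) +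
            PowerSeries.X ^ 1 * mk 1 ^ (2 * i + 2) := by
        linear_combination -(mk 1 ^ (2 * i + 1)) * X_mul_mk_one
      rw [h]
      exact add_mem (mul_mem_hilbertCone (by omega) (by omega) (hodd i))
        (mem_hilbertCone _ (by omega) (by omega))
  · have h : (2 * i + 1 + 1) / 2 = i + 1 := by omega
    rw [h]
    exact hodd i

/-- The product telescopes to `∑_{l<m} X h^(m-l) (h^(n-m+2l+1) - 1)`. The exponents are balanced so
that every summand has the same lower bound `m - l + ⌈(n - m + 2l + 1)/2⌉ = ⌊(n + m + 2)/2⌋`, while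
the largest exponent is `n + l + 1 ≤ n + m`. -/
lemma product_mem_hilbertCone {n m : ℕ} (hmn : m ≤ n) :
    (mk 1 ^ n - 1) * (mk 1 ^ m - 1) ∈ hilbertCone ((n + m + 2) / 2) (n + m) := by
  have htel : ∀ m : ℕ, ∑ l ∈ Finset.range m, PowerSeries.X * mk 1 ^ (l + 1) =
      (mk 1 ^ m - 1 : PowerSeries ℤ) := by
    intro m
    rw [← pow_zero (mk 1 : PowerSeries ℤ), ← Finset.sum_range_sub]
    refine Finset.sum_congr rfl fun l _ => ?_
    linear_combination mk 1 ^ l * X_mul_mk_one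
  have hsum : (mk 1 ^ n - 1) * (mk 1 ^ m - 1) =
      ∑ l ∈ Finset.range m, (PowerSeries.X ^ 1 * mk 1 ^ (m - l) *
        (mk 1 ^ (n - m + 2 * l + 1) - 1) : PowerSeries ℤ) := by
    have h1 : ∀ l ∈ Finset.range m, (PowerSeries.X ^ 1 * mk 1 ^ (m - l) *
        (mk 1 ^ (n - m + 2 * l + 1) - 1) : PowerSeries ℤ) =
        mk 1 ^ n * (PowerSeries.X * mk 1 ^ (l + 1)) -
          PowerSeries.X * mk 1 ^ ((m - 1 - l) + 1) := by
      intro l hl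
      have hl := Finset.mem_range.1 hl
      have h2 : m - l + (n - m + 2 * l + 1) = n + (l + 1) := by omega
      have h3 : m - 1 - l + 1 = m - l := by omega
      rw [h3, mul_sub, mul_assoc, ← pow_add, h2, pow_add]
      ring
    rw [Finset.sum_congr rfl h1, Finset.sum_sub_distrib, ← Finset.mul_sum,
      Finset.sum_range_reflect (fun l => (PowerSeries.X * mk 1 ^ (l + 1) : PowerSeries ℤ)) m, htel]
    ring
  rw [hsum]
  refine sum_mem fun l hl => ?_
  have hl := Finset.mem_range.1 hl
  exact mul_mem_hilbertCone (by omega) (by omega)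
    (mk_one_pow_sub_one_mem_hilbertCone (n - m + 2 * l + 1))

theorem le_hdepth_bipartiteIdeal {K : Type u} [Field K] {n m : ℕ} (hm : 1 ≤ m) (hmn : m ≤ n) :
    (((n + m + 2) / 2 : ℕ) : ℕ∞) ≤ hdepth (bipartiteIdeal K n m) := by
  obtain ⟨l, hl, hsum⟩ := AddSubmonoid.exists_list_of_mem_closure (product_mem_hilbertCone hmn)
  have hget : ∀ i : Fin l.length, ∃ a d, (n + m + 2) / 2 ≤ d ∧ d ≤ n + m ∧
      l.get i = PowerSeries.X ^ a * mk 1 ^ d := fun i => hl _ (List.get_mem l i)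
  choose a d hq hk hget using hget
  have hsum' : ∑ i, PowerSeries.X ^ a i * mk 1 ^ d i =
      ((mk 1 ^ n - 1) * (mk 1 ^ m - 1) : PowerSeries ℤ) := by
    rw [← hsum, ← List.sum_ofFn]
    congr 1
    refine List.ext_get (by simp) fun i h1 h2 => ?_
    simp [← hget]
  -- The decomposition has a term because `H(2) = nm` is not zero; otherwise the module would be
  -- zero and have no regular sequence.
  have hne : Nonempty (Fin l.length) := by
    by_contra hempty
    rw [not_nonempty_iff] at hempty
    rw [Finset.univ_eq_empty, Finset.sum_empty] at hsum'
    have h2 := hilbertSeries_bipartiteIdeal_natCast (K := K) (n := n) (m := m) 2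
    rw [← hsum', map_zero] at h2
    have h3 := hilbertSeries_bipartiteIdeal_two (K := K) (hm.trans hmn) hm
    have h4 : 0 < n * m := Nat.mul_pos (hm.trans hmn) hm
    rw [← h3] at h4
    exact h4.ne' (Nat.cast_eq_zero.1 h2)
  refine le_hilbertDepth_of_sum_eq a _ hq hk
    (fun j hj => hilbertSeries_bipartiteIdeal_of_neg hj) fun j => ?_
  rw [hsum', hilbertSeries_bipartiteIdeal_natCast]

end HilbertDecompositions

/-! ### Stanley decompositions from interval partitions -/

section StanleyDecompositions

variable {K : Type u} [Field K] {n m : ℕ}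

/-- The exponent of the squarefree monomial with the given support. -/
noncomputable def squarefreeExponent {σ : Type*} (A : Finset σ) : σ →₀ ℕ :=
  Finsupp.indicator A fun _ _ => 1

lemma squarefreeExponent_apply {σ : Type*} [DecidableEq σ] (A : Finset σ) (s : σ) :
    squarefreeExponent A s = if s ∈ A then 1 else 0 := by
  rw [squarefreeExponent, Finsupp.indicator_apply]
  split_ifs <;> rfl

lemma squarefreeExponent_le_iff {σ : Type*} {A : Finset σ} {e : σ →₀ ℕ} :
    squarefreeExponent A ≤ e ↔ A ⊆ e.support := by
  classical
  rw [Finsupp.le_def]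
  simp only [squarefreeExponent_apply]
  constructor
  · intro h s hs
    have := h s
    rw [if_pos hs] at this
    exact Finsupp.mem_support_iff.2 (by omega)
  · intro h s
    split_ifs with hs
    · exact Nat.one_le_iff_ne_zero.2 (Finsupp.mem_support_iff.1 (h hs))
    · exact Nat.zero_le _

/-- The squarefree monomial with support `A`, as an element of the ideal. -/
noncomputable def squarefreeMonomial (K : Type u) [Field K] {A : Finset (Fin (n + m))}
    (hA : squarefreeExponent A ∈ bipartiteExponents n m) : bipartiteIdeal K n m :=
  ⟨monomial (squarefreeExponent A) 1, mem_bipartiteIdeal_iff.2 fun e he => by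
    rwa [Finset.mem_singleton.1 (support_monomial_subset he)]⟩

/-- The multiples of `x^A` by monomials in the variables of `B ⊇ A` are exactly the monomials whose
support lies in the interval `[A, B]`. -/
lemma mem_stanleySpace_squarefreeMonomial_iff {A B : Finset (Fin (n + m))}
    (hA : squarefreeExponent A ∈ bipartiteExponents n m) (hAB : A ⊆ B) (f : bipartiteIdeal K n m) :
    f ∈ stanleySpace (K := K) (squarefreeMonomial K hA) B ↔
      ∀ e : bipartiteExponents n m, ¬ (A ⊆ e.1.support ∧ e.1.support ⊆ B) →
        (bipartiteBasis K n m).repr f e = 0 := by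
  classical
  rw [mem_stanleySpace_iff]
  constructor
  · rintro ⟨p, hp, rfl⟩ e he
    rw [bipartiteBasis_repr, Submodule.coe_smul, smul_eq_mul, squarefreeMonomial,
      coeff_mul_monomial']
    split_ifs with h
    · rw [mul_one]
      by_contra h0
      have h1 := mem_supported_iff_support.1 hp _ (mem_support_iff.2 h0)
      refine he ⟨squarefreeExponent_le_iff.1 h, fun s hs => ?_⟩
      by_cases hsA : s ∈ A
      · exact hAB hsA
      · refine h1 (Finsupp.mem_support_iff.2 ?_)
        rw [Finsupp.tsub_apply, squarefreeExponent_apply, if_neg hsA, tsub_zero]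
        exact Finsupp.mem_support_iff.1 hs
    · rfl
  · intro hf
    have hsupp : ∀ e, coeff e f.1 ≠ 0 → A ⊆ e.support ∧ e.support ⊆ B := by
      intro e he
      by_contra h
      exact he (hf ⟨e, mem_bipartiteIdeal_iff.1 f.2 e (mem_support_iff.2 he)⟩ h)
    refine ⟨f.1.divMonomial (squarefreeExponent A), mem_supported_iff_support.2 ?_,
      Subtype.ext (MvPolynomial.ext _ _ fun e => ?_)⟩
    · intro e he
      rw [mem_support_iff, coeff_divMonomial] at he
      exact (Finsupp.support_mono le_add_self).trans (hsupp _ he).2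
    · rw [Submodule.coe_smul, smul_eq_mul, squarefreeMonomial, coeff_mul_monomial', mul_one]
      split_ifs with h
      · rw [coeff_divMonomial, add_tsub_cancel_of_le h]
      · by_contra h0
        exact h (squarefreeExponent_le_iff.2 (hsupp e (Ne.symm h0)).1)

/-- A partition of the supports of the monomials of the ideal into intervals gives a Stanley
decomposition. -/
theorem le_sdepth_of_interval_partition {ι : Type*} [Finite ι]
    (A B : ι → Finset (Fin (n + m))) (hA : ∀ i, squarefreeExponent (A i) ∈ bipartiteExponents n m)
    (hAB : ∀ i, A i ⊆ B i)
    (huniq : ∀ e ∈ bipartiteExponents n m, ∃! i, A i ⊆ e.support ∧ e.support ⊆ B i)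
    {d : ℕ} (hd : ∀ i, d ≤ (B i).card) : (d : ℕ∞) ≤ sdepth (bipartiteIdeal K n m) := by
  obtain ⟨r, ⟨φ⟩⟩ := Finite.exists_equiv_fin ι
  choose w hw hw' using fun e : bipartiteExponents n m => huniq e.1 e.2
  let 𝒟 : StanleyDecomposition (multidegreePart (bipartiteIdeal K n m)) :=
    { r := r
      m := fun i => squarefreeMonomial K (hA (φ.symm i))
      Z := fun i => B (φ.symm i)
      homogeneous := fun i => ⟨fun s => squarefreeExponent (A (φ.symm i)) s, by
        refine (monomial_mem_restrictSupport (R := K)).2 (Or.inl fun s => rfl)⟩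
      free := by
        intro i p _ h
        have h1 : p * monomial (squarefreeExponent (A (φ.symm i))) (1 : K) = 0 :=
          congrArg Subtype.val h
        refine (mul_eq_zero.1 h1).resolve_right ?_
        rw [monomial_eq_zero]
        exact one_ne_zero
      isInternal := by
        refine isInternal_of_basis (bipartiteBasis K n m) (fun e => φ (w e)) _ fun i f => ?_
        rw [mem_stanleySpace_squarefreeMonomial_iff _ (hAB _)]
        refine forall_congr' fun e => ?_
        have h : φ (w e) ≠ i ↔ ¬ (A (φ.symm i) ⊆ e.1.support ∧ e.1.support ⊆ B (φ.symm i)) := by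
          refine not_congr ⟨?_, fun h => ?_⟩
          · rintro rfl
            rw [Equiv.symm_apply_apply]
            exact hw e
          · rw [← hw' e _ h, Equiv.apply_symm_apply]
        rw [h] }
  have h : (d : ℕ∞) ≤ 𝒟.sdepth := le_iInf fun i => Nat.cast_le.2 (hd (φ.symm i))
  exact h.trans (le_iSup (fun 𝒟 : StanleyDecomposition _ => 𝒟.sdepth) 𝒟)

/-- The union of a set of variables among the first `n` and one among the last `m`. -/
def joinFinset (A : Finset (Fin n)) (A' : Finset (Fin m)) : Finset (Fin (n + m)) :=
  (A.disjSum A').map finSumFinEquiv.toEmbedding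

lemma castAdd_mem_joinFinset {A : Finset (Fin n)} {A' : Finset (Fin m)} {i : Fin n} :
    Fin.castAdd m i ∈ joinFinset A A' ↔ i ∈ A := by
  rw [joinFinset, ← finSumFinEquiv_apply_left, ← Equiv.coe_toEmbedding, Finset.mem_map',
    Finset.inl_mem_disjSum]

lemma natAdd_mem_joinFinset {A : Finset (Fin n)} {A' : Finset (Fin m)} {j : Fin m} :
    Fin.natAdd n j ∈ joinFinset A A' ↔ j ∈ A' := by
  rw [joinFinset, ← finSumFinEquiv_apply_right, ← Equiv.coe_toEmbedding, Finset.mem_map',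
    Finset.inr_mem_disjSum]

lemma joinFinset_subset_iff {A C : Finset (Fin n)} {A' C' : Finset (Fin m)} :
    joinFinset A A' ⊆ joinFinset C C' ↔ A ⊆ C ∧ A' ⊆ C' := by
  constructor
  · intro h
    exact ⟨fun i hi => castAdd_mem_joinFinset.1 (h (castAdd_mem_joinFinset.2 hi)),
      fun j hj => natAdd_mem_joinFinset.1 (h (natAdd_mem_joinFinset.2 hj))⟩
  · rintro ⟨h, h'⟩ s
    refine Fin.addCases (fun i hi => ?_) (fun j hj => ?_) s
    · exact castAdd_mem_joinFinset.2 (h (castAdd_mem_joinFinset.1 hi))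
    · exact natAdd_mem_joinFinset.2 (h' (natAdd_mem_joinFinset.1 hj))

lemma card_joinFinset (A : Finset (Fin n)) (A' : Finset (Fin m)) :
    (joinFinset A A').card = A.card + A'.card := by
  rw [joinFinset, Finset.card_map, Finset.card_disjSum]

lemma support_eq_joinFinset (e : Fin (n + m) →₀ ℕ) :
    e.support = joinFinset (exponentEquiv n m e).1.support (exponentEquiv n m e).2.support := by
  ext s
  refine Fin.addCases (fun i => ?_) (fun j => ?_) s
  · rw [castAdd_mem_joinFinset, Finsupp.mem_support_iff, Finsupp.mem_support_iff,
      exponentEquiv_fst]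
  · rw [natAdd_mem_joinFinset, Finsupp.mem_support_iff, Finsupp.mem_support_iff,
      exponentEquiv_snd]

/-- A monomial lies in the ideal when both halves of its support are nonempty, so products of
intervals from the two partitions cover each such support exactly once, and the sizes of the upper
ends add. -/
theorem le_sdepth_bipartiteIdeal (hn : 1 ≤ n) (hm : 1 ≤ m) :
    (((n + 1) / 2 + (m + 1) / 2 : ℕ) : ℕ∞) ≤ sdepth (bipartiteIdeal K n m) := by
  classical
  obtain ⟨P, hP, hPu⟩ := exists_interval_partition hn
  obtain ⟨Q, hQ, hQu⟩ := exists_interval_partition hm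
  refine le_sdepth_of_interval_partition (ι := P × Q)
    (fun I => joinFinset I.1.1.1 I.2.1.1) (fun I => joinFinset I.1.1.2 I.2.1.2) ?_ ?_ ?_ ?_
  · rintro ⟨⟨I, hI⟩, ⟨J, hJ⟩⟩
    obtain ⟨i, hi⟩ := (hP I hI).1
    obtain ⟨j, hj⟩ := (hQ J hJ).1
    refine ⟨⟨i, ?_⟩, ⟨j, ?_⟩⟩
    · rw [squarefreeExponent_apply, if_pos (castAdd_mem_joinFinset.2 hi)]
      exact one_ne_zero
    · rw [squarefreeExponent_apply, if_pos (natAdd_mem_joinFinset.2 hj)]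
      exact one_ne_zero
  · rintro ⟨⟨I, hI⟩, ⟨J, hJ⟩⟩
    exact joinFinset_subset_iff.2 ⟨(hP I hI).2.1, (hQ J hJ).2.1⟩
  · intro e he
    rw [mem_bipartiteExponents_iff] at he
    have hne : ∀ {k : ℕ} (g : Fin k →₀ ℕ), g.degree ≠ 0 → g.support.Nonempty := by
      intro k g hg
      rw [Finsupp.support_nonempty_iff]
      rintro rfl
      exact hg (map_zero _)
    obtain ⟨I, ⟨hI, hI1, hI2⟩, hIu⟩ := hPu _ (hne _ he.1)
    obtain ⟨J, ⟨hJ, hJ1, hJ2⟩, hJu⟩ := hQu _ (hne _ he.2)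
    rw [support_eq_joinFinset]
    refine ⟨(⟨I, hI⟩, ⟨J, hJ⟩), ⟨joinFinset_subset_iff.2 ⟨hI1, hJ1⟩,
      joinFinset_subset_iff.2 ⟨hI2, hJ2⟩⟩, ?_⟩
    rintro ⟨⟨I', hI'⟩, ⟨J', hJ'⟩⟩ ⟨h1, h2⟩
    rw [joinFinset_subset_iff] at h1 h2
    obtain rfl := hIu I' ⟨hI', h1.1, h2.1⟩
    obtain rfl := hJu J' ⟨hJ', h1.2, h2.2⟩
    rfl
  · rintro ⟨⟨I, hI⟩, ⟨J, hJ⟩⟩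
    rw [card_joinFinset]
    exact Nat.add_le_add (hP I hI).2.2 (hQ J hJ).2.2

end StanleyDecompositions

theorem hdepth_bipartiteIdeal {K : Type u} [Field K] {n m : ℕ} (hm : 1 ≤ m) (hmn : m ≤ n) :
    hdepth (bipartiteIdeal K n m) = (((n + m + 2) / 2 : ℕ) : ℕ∞) :=
  le_antisymm (hdepth_bipartiteIdeal_le (hm.trans hmn) hm) (le_hdepth_bipartiteIdeal hm hmn)

end StanleyHilbert

/-! ### Rounding, and the main theorem -/

lemma Nat.ceil_cast_div_two (n : ℕ) : ⌈(n : ℚ) / 2⌉₊ = (n + 1) / 2 := by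
  refine le_antisymm (Nat.ceil_le.2 ?_) ?_
  · rw [div_le_iff₀ (by norm_num)]
    have : n ≤ (n + 1) / 2 * 2 := by omega
    exact_mod_cast this
  · have h := Nat.le_ceil ((n : ℚ) / 2)
    rw [div_le_iff₀ (by norm_num)] at h
    have h' : n ≤ ⌈(n : ℚ) / 2⌉₊ * 2 := by exact_mod_cast h
    omega

lemma Nat.floor_cast_add_div_two (n m : ℕ) : ⌊((n : ℚ) + m + 2) / 2⌋₊ = (n + m + 2) / 2 := by
  have h : ((n : ℚ) + m + 2) / 2 = ((n + m + 2 : ℕ) : ℚ) / (2 : ℕ) := by push_cast; rfl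
  rw [h, Nat.floor_div_eq_div]

theorem theorem2p6 {K : Type u} [Field K] (n m : ℕ) (hm : 1 ≤ m) (hmn : m ≤ n) :
    (¬ (Even n ∧ Even m) →
      StanleyHilbert.sdepth (StanleyHilbert.bipartiteIdeal K n m) =
          StanleyHilbert.hdepth (StanleyHilbert.bipartiteIdeal K n m) ∧
        StanleyHilbert.hdepth (StanleyHilbert.bipartiteIdeal K n m) =
          ((⌈(n : ℚ) / 2⌉₊ + ⌈(m : ℚ) / 2⌉₊ : ℕ) : ℕ∞)) ∧
    (∀ t s : ℕ, n = 2 * t → m = 2 * s →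
      ((t + s : ℕ) : ℕ∞) ≤ StanleyHilbert.sdepth (StanleyHilbert.bipartiteIdeal K n m) ∧
        StanleyHilbert.sdepth (StanleyHilbert.bipartiteIdeal K n m) ≤
          StanleyHilbert.hdepth (StanleyHilbert.bipartiteIdeal K n m) ∧
        StanleyHilbert.hdepth (StanleyHilbert.bipartiteIdeal K n m) = ((t + s + 1 : ℕ) : ℕ∞)) ∧
    StanleyHilbert.hdepth (StanleyHilbert.bipartiteIdeal K n m) =
      ((⌊((n : ℚ) + m + 2) / 2⌋₊ : ℕ) : ℕ∞) := by
  have hn := hm.trans hmn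
  have hh := StanleyHilbert.hdepth_bipartiteIdeal (K := K) hm hmn
  have hle := StanleyHilbert.sdepth_bipartiteIdeal_le (K := K) hn hm
  have hge := StanleyHilbert.le_sdepth_bipartiteIdeal (K := K) hn hm
  -- Once `hdepth` is replaced by its value, the upper bound `hle` is the inequality between Stanley
  -- depth and Hilbert depth.
  rw [hh, Nat.ceil_cast_div_two, Nat.ceil_cast_div_two, Nat.floor_cast_add_div_two]
  refine ⟨fun hpar => ?_, fun t s ht hs => ⟨?_, hle, ?_⟩, rfl⟩
  -- The only place where parity matters: an odd `n` or `m` makes the lower and upper bounds meet.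
  · have h : (n + 1) / 2 + (m + 1) / 2 = (n + m + 2) / 2 := by
      rw [Nat.even_iff, Nat.even_iff] at hpar
      omega
    rw [h] at hge ⊢
    exact ⟨le_antisymm hle hge, rfl⟩
  · refine le_trans (Nat.cast_le.2 ?_) hge
    omega
  · congr 1
    omega
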